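/- Let $U$ and $W$ be two disjoint sets of $n$ agents each. A preference profile $P$ assigns to every agent a strict linear order on a subset of the opposite set; the members of this subset are the agents acceptable to her. A matching of $P$ is a set of pairwise disjoint pairs $\{u,w\}$ with $u\in U$, $w\in W$ that are mutually acceptable. It is stable in $P$ if there is no pair $\{u,w\}\notin M$ of mutually acceptable agents such that each of the two is unmatched or prefers the other one to her partner in $M$; it is perfect if every agent is matched. The swap distance of two profiles is the sum, over all agents, of the number of pairs ordered differently in the agent's two lists (and $\infty$ if some agent's two lists rank different sets). The problem Globally Nearly Stable Perfect Matching asks, given $P$ and $d\in\mathbb N$, whether there are a profile $P'$ at swap distance at most $d$ from $P$ and a perfect matching that is stable in $P'$. Let $n_m$ be the number of agents of $U\cup W$ that are initially matched, i.e. contained in some stable matching of $P$. The computation model is a word RAM with unit-cost operations and words of $O(\log(N+d))$ bits, where $N$ is the input size, that is, the number of words of the input ($n$, $d$, and all preference lists). Then: 1. Globally Nearly Stable Perfect Matching can be solved in $O\bigl(n_m^{\,n_m^2\cdot\log n_m}\cdot n^2\bigr)$ time for $n\ge 1$ (with the convention that $n_m^{\,n_m^2\cdot\log n_m}=1$ for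 $n_m=0$), and in $O(1)$ time for $n=0$. 2. Globally Nearly Stable Perfect Matching, parameterized by $n_m$, admits a problem kernel with at most $\max(2n_m,2)$ agents (hence at most $2n_m$ agents whenever $n_m>0$) that can be computed in linear time: there are a computable function $g$ and an algorithm that, given $(P,d)$, computes in $O(N)$ time an instance $(P',d')$ that is a yes-instance if and only if $(P,d)$ is, that has at most $\max(2n_m,2)$ agents in total, and whose number of words plus $d'$ is at most $g(n_m)$. -/

import Mathlib

/-! ### Preference profiles, stable matchings, swap distance -/

/-- A preference profile for agent sets `U = {u_0, …, u_{n-1}}` and `W = {w_0, …, w_{n-1}}`.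
A linear order on a subset of the opposite side is given by the duplicate-free list of its
members, the most preferred agent first; the agents not in the list are unacceptable. -/
structure Profile (n : ℕ) where
  prefU : Fin n → List (Fin n)
  prefW : Fin n → List (Fin n)
  nodupU : ∀ u, (prefU u).Nodup
  nodupW : ∀ w, (prefW w).Nodup

namespace Profile

variable {n : ℕ}

/-- The rank of `w` in the list of `u`: the number of agents that `u` prefers to `w`, and the
number of all agents acceptable to `u` if `w` is unacceptable to `u`
(`List.idxOf` returns the length of the list for a non-member). -/
def rkU (P : Profile n) (u w : Fin n) : ℕ := (P.prefU u).idxOf w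

/-- The rank of `u` in the list of `w`. -/
def rkW (P : Profile n) (w u : Fin n) : ℕ := (P.prefW w).idxOf u

/-- `u` and `w` find each other acceptable. -/
def Acceptable (P : Profile n) (u w : Fin n) : Prop := w ∈ P.prefU u ∧ u ∈ P.prefW w

/-- A set of pairwise disjoint pairs `(u, w)` of agents who find each other acceptable. -/
def IsMatching (P : Profile n) (M : Finset (Fin n × Fin n)) : Prop :=
  (∀ p ∈ M, P.Acceptable p.1 p.2) ∧
  (∀ p ∈ M, ∀ q ∈ M, p ≠ q → p.1 ≠ q.1 ∧ p.2 ≠ q.2)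

/-- The pair `{u, w}` blocks `M`. The last two clauses say that the agent is unmatched or
ranks the other one higher than the partner. -/
def Blocks (P : Profile n) (M : Finset (Fin n × Fin n)) (u w : Fin n) : Prop :=
  P.Acceptable u w ∧ (u, w) ∉ M ∧
  (∀ w', (u, w') ∈ M → P.rkU u w < P.rkU u w') ∧
  (∀ u', (u', w) ∈ M → P.rkW w u < P.rkW w u')

def IsStable (P : Profile n) (M : Finset (Fin n × Fin n)) : Prop :=
  P.IsMatching M ∧ ∀ u w, ¬ P.Blocks M u w

/-- The number of pairs `{x, y}` that the two lists order differently (each such pair is counted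
once, as the ordered pair whose first component comes first in `l`); infinite if the lists
rank different sets of agents. -/
def listSwapDist (l l' : List (Fin n)) : ℕ∞ :=
  if l.toFinset = l'.toFinset then
    (((l.toFinset ×ˢ l.toFinset).filter fun p =>
      l.idxOf p.1 < l.idxOf p.2 ∧ l'.idxOf p.2 < l'.idxOf p.1).card : ℕ∞)
  else ⊤

/-- The swap distance of two profiles: the sum of the swap distances over all agents. -/
def swapDist (P Q : Profile n) : ℕ∞ :=
  (∑ u, listSwapDist (P.prefU u) (Q.prefU u)) + ∑ w, listSwapDist (P.prefW w) (Q.prefW w)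

/-- `M` is globally `d`-nearly stable for `P`. -/
def GloballyNearlyStable (P : Profile n) (d : ℕ) (M : Finset (Fin n × Fin n)) : Prop :=
  ∃ Q : Profile n, P.swapDist Q ≤ d ∧ Q.IsStable M

/-- The agent `x` (`Sum.inl u` is `u ∈ U`, `Sum.inr w` is `w ∈ W`) has a partner in `M`. -/
def IsMatchedBy (M : Finset (Fin n × Fin n)) (x : Fin n ⊕ Fin n) : Prop :=
  match x with
  | Sum.inl u => ∃ w, (u, w) ∈ M
  | Sum.inr w => ∃ u, (u, w) ∈ M

def IsPerfect (M : Finset (Fin n × Fin n)) : Prop := ∀ x : Fin n ⊕ Fin n, IsMatchedBy M x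

/-- An agent is initially unmatched if no stable matching of `P` contains it, and initially
matched otherwise. -/
def InitiallyMatched (P : Profile n) (x : Fin n ⊕ Fin n) : Prop :=
  ∃ M, P.IsStable M ∧ IsMatchedBy M x

/-- The number of initially matched agents (of both sides together). -/
noncomputable def numMatched (P : Profile n) : ℕ := Nat.card {x // P.InitiallyMatched x}

end Profile

/-! ### The decision problem -/

/-- An instance of Globally Nearly Stable Perfect Matching. -/
structure GNSPM where
  n : ℕ
  profile : Profile n
  d : ℕ

namespace GNSPM

/-- There is a perfect matching that is globally `d`-nearly stable. -/
def IsYes (I : GNSPM) : Prop :=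
  ∃ M, I.profile.GloballyNearlyStable I.d M ∧ Profile.IsPerfect M

/-- The parameter: the number of initially matched agents. -/
noncomputable def nm (I : GNSPM) : ℕ := I.profile.numMatched

/-- A preference list as a sequence of words: its length, then its members in order. -/
def encodeList {n : ℕ} (l : List (Fin n)) : List ℕ := l.length :: l.map Fin.val

/-- An instance as a sequence of words: `n`, `d`, the preference lists of `u_0, u_1, …`, and
those of `w_0, w_1, …`. -/
def encode (I : GNSPM) : List ℕ :=
  I.n :: I.d ::
    ((List.finRange I.n).flatMap (fun u => encodeList (I.profile.prefU u)) ++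
     (List.finRange I.n).flatMap (fun w => encodeList (I.profile.prefW w)))

/-- The input size: the number of words of the input. -/
def size (I : GNSPM) : ℕ := I.encode.length

/-- The largest word available on input `I`: `(size + d) ^ k`, so that words have
`O(log (size + d))` bits. -/
def maxWord (I : GNSPM) (k : ℕ) : ℕ := (I.size + I.d) ^ k

end GNSPM

/-! ### The machine model: a word RAM

Programs are while-programs over a random access memory and finitely many registers. Every
elementary operation costs one step. All numbers (values and addresses) that occur have to be at
most the largest word `B`: a computation that exceeds `B` is stuck, and does not count as halting.
-/

namespace WordRAM

structure State where
  reg : ℕ → ℕ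
  mem : ℕ → ℕ

inductive Expr where
  | lit (c : ℕ)
  | reg (x : ℕ)
  | mem (a : Expr)
  | add (a b : Expr)
  | sub (a b : Expr)
  | mul (a b : Expr)
  | lt (a b : Expr)
  | eq (a b : Expr)

namespace Expr

/-- Subtraction is truncated; comparisons return `1` or `0`. -/
def eval (s : State) : Expr → ℕ
  | lit c => c
  | reg x => s.reg x
  | mem a => s.mem (a.eval s)
  | add a b => a.eval s + b.eval s
  | sub a b => a.eval s - b.eval s
  | mul a b => a.eval s * b.eval s
  | lt a b => if a.eval s < b.eval s then 1 else 0
  | eq a b => if a.eval s = b.eval s then 1 else 0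

/-- The number of steps of evaluating an expression: its number of nodes. -/
def cost : Expr → ℕ
  | lit _ => 1
  | reg _ => 1
  | mem a => a.cost + 1
  | add a b => a.cost + b.cost + 1
  | sub a b => a.cost + b.cost + 1
  | mul a b => a.cost + b.cost + 1
  | lt a b => a.cost + b.cost + 1
  | eq a b => a.cost + b.cost + 1

/-- Every value computed in the evaluation (of the expression and all its parts) is at
most `B`. -/
def Fits (B : ℕ) (s : State) : Expr → Prop
  | lit c => c ≤ B
  | reg x => s.reg x ≤ B
  | mem a => a.Fits B s ∧ s.mem (a.eval s) ≤ B
  | add a b => a.Fits B s ∧ b.Fits B s ∧ a.eval s + b.eval s ≤ B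
  | sub a b => a.Fits B s ∧ b.Fits B s
  | mul a b => a.Fits B s ∧ b.Fits B s ∧ a.eval s * b.eval s ≤ B
  | lt a b => a.Fits B s ∧ b.Fits B s ∧ 1 ≤ B
  | eq a b => a.Fits B s ∧ b.Fits B s ∧ 1 ≤ B

end Expr

inductive Cmd where
  | skip
  /-- register `x` := `e` -/
  | assign (x : ℕ) (e : Expr)
  /-- memory cell with address `a` := `e` -/
  | store (a e : Expr)
  | seq (c₁ c₂ : Cmd)
  /-- run `c₁` if the value of `e` is not `0`, and `c₂` otherwise -/
  | ite (e : Expr) (c₁ c₂ : Cmd)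
  /-- repeat `c` as long as the value of `e` is not `0` -/
  | loop (e : Expr) (c : Cmd)

/-- `Exec B c s t s'`: with largest word `B`, the program `c` started in state `s` halts after
exactly `t` steps in state `s'`. -/
inductive Exec (B : ℕ) : Cmd → State → ℕ → State → Prop
  | skip (s : State) : Exec B Cmd.skip s 1 s
  | assign (s : State) (x : ℕ) (e : Expr) (he : e.Fits B s) :
      Exec B (Cmd.assign x e) s (e.cost + 1)
        { s with reg := Function.update s.reg x (e.eval s) }
  | store (s : State) (a e : Expr) (ha : a.Fits B s) (he : e.Fits B s) :
      Exec B (Cmd.store a e) s (a.cost + e.cost + 1)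
        { s with mem := Function.update s.mem (a.eval s) (e.eval s) }
  | seq {s s₁ s₂ : State} {c₁ c₂ : Cmd} {t₁ t₂ : ℕ}
      (h₁ : Exec B c₁ s t₁ s₁) (h₂ : Exec B c₂ s₁ t₂ s₂) :
      Exec B (Cmd.seq c₁ c₂) s (t₁ + t₂) s₂
  | ite_true {s s' : State} {e : Expr} {c₁ c₂ : Cmd} {t : ℕ}
      (he : e.Fits B s) (hv : e.eval s ≠ 0) (h : Exec B c₁ s t s') :
      Exec B (Cmd.ite e c₁ c₂) s (e.cost + 1 + t) s'
  | ite_false {s s' : State} {e : Expr} {c₁ c₂ : Cmd} {t : ℕ}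
      (he : e.Fits B s) (hv : e.eval s = 0) (h : Exec B c₂ s t s') :
      Exec B (Cmd.ite e c₁ c₂) s (e.cost + 1 + t) s'
  | loop_true {s s₁ s₂ : State} {e : Expr} {c : Cmd} {t₁ t₂ : ℕ}
      (he : e.Fits B s) (hv : e.eval s ≠ 0)
      (h₁ : Exec B c s t₁ s₁) (h₂ : Exec B (Cmd.loop e c) s₁ t₂ s₂) :
      Exec B (Cmd.loop e c) s (e.cost + 1 + t₁ + t₂) s₂
  | loop_false {s : State} {e : Expr} {c : Cmd} (he : e.Fits B s) (hv : e.eval s = 0) :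
      Exec B (Cmd.loop e c) s (e.cost + 1) s

/-- The initial state: the input stands in the memory cells `0, 1, …`; all other cells and all
registers are `0`. -/
def State.init (xs : List ℕ) : State where
  reg := fun _ => 0
  mem := fun i => xs.getD i 0

/-- The output `ys` stands in consecutive memory cells, the first of which has its address in
register `0`. -/
def State.Outputs (s : State) (ys : List ℕ) : Prop :=
  ∀ i (hi : i < ys.length), s.mem (s.reg 0 + i) = ys[i]

/-- The answer of a decision algorithm stands in register `0`: `1` for yes, `0` for no. -/
def State.Answers (s : State) (p : Prop) : Prop :=
  (p → s.reg 0 = 1) ∧ (¬ p → s.reg 0 = 0)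

end WordRAM

/-! Deferred acceptance yields one stable matching `M` of `P`. Two agents that `M` leaves unmatched
are never mutually acceptable, as they would block `M`, and a profile at finite swap distance has
the same acceptable pairs. So every pair of a perfect nearly stable matching contains an agent of
`M`, and a yes-instance satisfies `n ≤ 2|M|` (`le_two_mul_card`). On the other hand `2|M| ≤ n_m`,
because the agents of `M` are distinct and initially matched (`two_mul_card_le`). Comparing `n` with
`2|M|` therefore leaves two cases: the answer is no, or `n ≤ n_m` and all lists are bounded in terms
of the parameter. The theorem that all stable matchings cover the same agents is not needed.

Kernel: the first case gives a fixed no-instance, the second the instance itself with `d` capped at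
`2n³`, since no finite swap distance is larger (`swapDist_le`, `isYes_cap`). The time is linear
because every step of deferred acceptance consumes a list entry or starts a new agent.

Decision: the second case is settled by exhaustive search. A certificate is a table with `2n` rows
of `n + 1` digits below `n`: new ranks for the agents of the other side, and a partner. Its cost
counts the inverted pairs and adds at least `d + 1` if there is any defect, so the instance is a
yes-instance iff some certificate costs at most `d` (`certCost_le_iff`, `isYes_of_certificate`,
`exists_certificate`). There are `n^(2n(n+1))` certificates, each examined in `O((n+1)³)` steps. The
exponent is only quadratic, so the factor `log n_m` in the claimed bound absorbs it for large `n_m`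
(`exists_searchTime_le_rpow`).

Machine: all stored numbers are at most `bnd = (size + d)^8`, and loop-free fragments of cost at
most 1000 have intermediate values at most `bnd ^ 1000` (`Exec.of_bounded`). Correctness and time
then follow from symbolic execution of the loop bodies (`Runs.straight`) together with an invariant
and a measure for each loop (`Runs.loop`). -/

set_option linter.unusedSimpArgs false

/-! ### Running word RAM programs -/

namespace WordRAM

/-- All registers and memory cells hold numbers at most `b`. -/
def State.Bdd (b : ℕ) (s : State) : Prop := (∀ x, s.reg x ≤ b) ∧ ∀ a, s.mem a ≤ b

namespace Expr

/-- The largest literal of an expression. -/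
def maxLit : Expr → ℕ
  | lit c => c
  | reg _ => 0
  | mem a => a.maxLit
  | add a b => max a.maxLit b.maxLit
  | sub a b => max a.maxLit b.maxLit
  | mul a b => max a.maxLit b.maxLit
  | lt a b => max a.maxLit b.maxLit
  | eq a b => max a.maxLit b.maxLit

theorem Fits.mono {B B' : ℕ} (h : B ≤ B') {s : State} {e : Expr} (he : e.Fits B s) :
    e.Fits B' s := by
  induction e with
  | lit c => exact le_trans he h
  | reg x => exact le_trans he h
  | mem a iha => exact ⟨iha he.1, he.2.trans h⟩
  | add a b iha ihb => exact ⟨iha he.1, ihb he.2.1, he.2.2.trans h⟩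
  | sub a b iha ihb => exact ⟨iha he.1, ihb he.2⟩
  | mul a b iha ihb => exact ⟨iha he.1, ihb he.2.1, he.2.2.trans h⟩
  | lt a b iha ihb => exact ⟨iha he.1, ihb he.2.1, he.2.2.trans h⟩
  | eq a b iha ihb => exact ⟨iha he.1, ihb he.2.1, he.2.2.trans h⟩

/-- Evaluating an expression of cost `m` on numbers at most `b` yields numbers at most `b ^ m`. -/
theorem eval_le_and_fits {b : ℕ} (hb : 2 ≤ b) {s : State} (hs : s.Bdd b) (e : Expr)
    (he : e.maxLit ≤ b) : e.eval s ≤ b ^ e.cost ∧ e.Fits (b ^ e.cost) s := by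
  have hpos : ∀ m, 1 ≤ b ^ m := fun m => Nat.one_le_pow _ _ (by omega)
  have mono : ∀ {i j : ℕ}, i ≤ j → b ^ i ≤ b ^ j := fun h => Nat.pow_le_pow_right (by omega) h
  have ble : ∀ m, b ≤ b ^ (m + 1) := fun m => Nat.le_self_pow (by omega) b
  induction e with
  | lit c => simpa [eval, cost, Fits, maxLit] using he
  | reg x => simpa [eval, cost, Fits] using hs.1 x
  | mem a iha =>
    have := iha he
    exact ⟨(hs.2 _).trans (ble _), this.2.mono (mono (Nat.le_succ _)), (hs.2 _).trans (ble _)⟩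
  | add a c iha ihc =>
    have ha := iha ((le_max_left _ _).trans he)
    have hc := ihc ((le_max_right _ _).trans he)
    have key : a.eval s + c.eval s ≤ b ^ (a.cost + c.cost + 1) := by
      have h1 : b ^ a.cost ≤ b ^ (a.cost + c.cost) := mono (by omega)
      have h2 : b ^ c.cost ≤ b ^ (a.cost + c.cost) := mono (by omega)
      calc a.eval s + c.eval s ≤ b ^ (a.cost + c.cost) * 2 := by linarith [ha.1, hc.1]
        _ ≤ _ := by rw [pow_succ]; exact Nat.mul_le_mul_left _ hb
    exact ⟨key, ha.2.mono (mono (by simp only [cost]; omega)),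
      hc.2.mono (mono (by simp only [cost]; omega)), key⟩
  | sub a c iha ihc =>
    have ha := iha ((le_max_left _ _).trans he)
    have hc := ihc ((le_max_right _ _).trans he)
    exact ⟨(Nat.sub_le _ _).trans (ha.1.trans (mono (by simp only [cost]; omega))),
      ha.2.mono (mono (by simp only [cost]; omega)),
      hc.2.mono (mono (by simp only [cost]; omega))⟩
  | mul a c iha ihc =>
    have ha := iha ((le_max_left _ _).trans he)
    have hc := ihc ((le_max_right _ _).trans he)
    have key : a.eval s * c.eval s ≤ b ^ (a.cost + c.cost + 1) :=
      (Nat.mul_le_mul ha.1 hc.1).trans (by rw [← pow_add]; exact mono (by omega))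
    exact ⟨key, ha.2.mono (mono (by simp only [cost]; omega)),
      hc.2.mono (mono (by simp only [cost]; omega)), key⟩
  | lt a c iha ihc =>
    have ha := iha ((le_max_left _ _).trans he)
    have hc := ihc ((le_max_right _ _).trans he)
    refine ⟨?_, ha.2.mono (mono (by simp only [cost]; omega)),
      hc.2.mono (mono (by simp only [cost]; omega)), hpos _⟩
    have := hpos (Expr.lt a c).cost
    simp only [eval]; split_ifs <;> omega
  | eq a c iha ihc =>
    have ha := iha ((le_max_left _ _).trans he)
    have hc := ihc ((le_max_right _ _).trans he)
    refine ⟨?_, ha.2.mono (mono (by simp only [cost]; omega)),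
      hc.2.mono (mono (by simp only [cost]; omega)), hpos _⟩
    have := hpos (Expr.eq a c).cost
    simp only [eval]; split_ifs <;> omega

end Expr

namespace Cmd

/-- The largest literal of a program. -/
def maxLit : Cmd → ℕ
  | skip => 0
  | assign _ e => e.maxLit
  | store a e => max a.maxLit e.maxLit
  | seq c₁ c₂ => max c₁.maxLit c₂.maxLit
  | ite e c₁ c₂ => max e.maxLit (max c₁.maxLit c₂.maxLit)
  | loop e c => max e.maxLit c.maxLit

/-- The cost of all instructions of a program together; it bounds the time if there are no
loops. -/
def cost : Cmd → ℕ
  | skip => 1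
  | assign _ e => e.cost + 1
  | store a e => a.cost + e.cost + 1
  | seq c₁ c₂ => c₁.cost + c₂.cost
  | ite e c₁ c₂ => e.cost + 1 + c₁.cost + c₂.cost
  | loop e c => e.cost + 1 + c.cost

/-- The final state of a loop-free program. -/
def result : Cmd → State → State
  | skip, s => s
  | assign x e, s => { s with reg := Function.update s.reg x (e.eval s) }
  | store a e, s => { s with mem := Function.update s.mem (a.eval s) (e.eval s) }
  | seq c₁ c₂, s => c₂.result (c₁.result s)
  | ite e c₁ c₂, s => if e.eval s = 0 then c₂.result s else c₁.result s
  | loop _ _, s => s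

/-- The program is loop-free, and all numbers that it writes are at most `b`. -/
def Bounded (b : ℕ) : Cmd → State → Prop
  | skip, _ => True
  | assign _ e, s => e.eval s ≤ b
  | store _ e, s => e.eval s ≤ b
  | seq c₁ c₂, s => c₁.Bounded b s ∧ c₂.Bounded b (c₁.result s)
  | ite e c₁ c₂, s => if e.eval s = 0 then c₂.Bounded b s else c₁.Bounded b s
  | loop _ _, _ => False

end Cmd

/-- Only the numbers that are written have to be at most `b`. Intermediate results may be larger,
but an expression costs no more than the program that contains it, so they stay below `b ^ c.cost`.
-/
theorem Exec.of_bounded {b B : ℕ} (hb : 2 ≤ b) (c : Cmd) {s : State} (hs : s.Bdd b)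
    (hc : c.Bounded b s) (hl : c.maxLit ≤ b) (hB : b ^ c.cost ≤ B) :
    (∃ t ≤ c.cost, Exec B c s t (c.result s)) ∧ (c.result s).Bdd b := by
  have mono : ∀ {i j : ℕ}, i ≤ j → b ^ i ≤ b ^ j := fun h => Nat.pow_le_pow_right (by omega) h
  induction c generalizing s with
  | skip => exact ⟨⟨1, le_rfl, .skip s⟩, hs⟩
  | assign x e =>
    refine ⟨⟨_, le_rfl, .assign s x e (((e.eval_le_and_fits hb hs hl).2).mono
      ((mono (by simp only [Cmd.cost]; omega)).trans hB))⟩, fun y => ?_, hs.2⟩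
    change Function.update s.reg x (e.eval s) y ≤ b
    rw [Function.update_apply]
    split_ifs
    exacts [hc, hs.1 y]
  | store a e =>
    refine ⟨⟨_, le_rfl, .store s a e
      (((a.eval_le_and_fits hb hs ((le_max_left _ _).trans hl)).2).mono
        ((mono (by simp only [Cmd.cost]; omega)).trans hB))
      (((e.eval_le_and_fits hb hs ((le_max_right _ _).trans hl)).2).mono
        ((mono (by simp only [Cmd.cost]; omega)).trans hB))⟩, hs.1, fun y => ?_⟩
    change Function.update s.mem (a.eval s) (e.eval s) y ≤ b
    rw [Function.update_apply]
    split_ifs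
    exacts [hc, hs.2 y]
  | seq c₁ c₂ ih₁ ih₂ =>
    obtain ⟨⟨t₁, ht₁, h₁⟩, hs₁⟩ := ih₁ hs hc.1 ((le_max_left _ _).trans hl)
      ((mono (by simp only [Cmd.cost]; omega)).trans hB)
    obtain ⟨⟨t₂, ht₂, h₂⟩, hs₂⟩ := ih₂ hs₁ hc.2 ((le_max_right _ _).trans hl)
      ((mono (by simp only [Cmd.cost]; omega)).trans hB)
    exact ⟨⟨_, Nat.add_le_add ht₁ ht₂, .seq h₁ h₂⟩, hs₂⟩
  | ite e c₁ c₂ ih₁ ih₂ =>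
    have he := ((e.eval_le_and_fits hb hs ((le_max_left _ _).trans hl)).2).mono
      ((mono (j := (Cmd.ite e c₁ c₂).cost) (by simp only [Cmd.cost]; omega)).trans hB)
    have hl' := (le_max_right _ _).trans hl
    by_cases h0 : e.eval s = 0
    · simp only [Cmd.Bounded, h0, if_true] at hc
      obtain ⟨⟨t, ht, h⟩, hs'⟩ := ih₂ hs hc ((le_max_right _ _).trans hl')
        ((mono (by simp only [Cmd.cost]; omega)).trans hB)
      simp only [Cmd.result, h0, if_true]
      exact ⟨⟨_, by simp only [Cmd.cost]; omega, .ite_false he h0 h⟩, hs'⟩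
    · simp only [Cmd.Bounded, h0, if_false] at hc
      obtain ⟨⟨t, ht, h⟩, hs'⟩ := ih₁ hs hc ((le_max_left _ _).trans hl')
        ((mono (by simp only [Cmd.cost]; omega)).trans hB)
      simp only [Cmd.result, h0, if_false]
      exact ⟨⟨_, by simp only [Cmd.cost]; omega, .ite_true he h0 h⟩, hs'⟩
  | loop e c _ => exact hc.elim

/-! ### Time-bounded rules for composition, branching and loops -/

/-- Started in `s`, the program `c` halts within `T` steps in a state satisfying `Q`. -/
def Runs (B : ℕ) (c : Cmd) (s : State) (T : ℕ) (Q : State → Prop) : Prop :=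
  ∃ t s', Exec B c s t s' ∧ t ≤ T ∧ Q s'

namespace Runs

variable {B : ℕ} {s : State} {T : ℕ} {Q : State → Prop}

theorem mono {c : Cmd} {T' : ℕ} {Q' : State → Prop} (h : Runs B c s T Q) (hT : T ≤ T')
    (hQ : ∀ s', Q s' → Q' s') : Runs B c s T' Q' := by
  obtain ⟨t, s', h₁, h₂, h₃⟩ := h
  exact ⟨t, s', h₁, h₂.trans hT, hQ _ h₃⟩

/-- One format for every loop-free fragment: 256 bounds all literals and `K` all costs, so a single
hypothesis `b ^ K ≤ B` serves them all. Boundedness of the final state is handed to `Q`, because the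
loop invariants contain it. -/
theorem straight {b K : ℕ} (hb : 256 ≤ b) (hB : b ^ K ≤ B) {c : Cmd} (hs : s.Bdd b)
    (hc : c.Bounded b s) (hl : c.maxLit ≤ 256) (hK : c.cost ≤ K) (hT : c.cost ≤ T)
    (hQ : (c.result s).Bdd b → Q (c.result s)) : Runs B c s T Q := by
  obtain ⟨⟨t, ht, h⟩, hs'⟩ := Exec.of_bounded (by omega) c hs hc (hl.trans hb)
    ((Nat.pow_le_pow_right (by omega) hK).trans hB)
  exact ⟨t, _, h, ht.trans hT, hQ hs'⟩

theorem seq {c₁ c₂ : Cmd} {T₁ T₂ : ℕ} {Q₁ : State → Prop} (h₁ : Runs B c₁ s T₁ Q₁)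
    (h₂ : ∀ s', Q₁ s' → Runs B c₂ s' T₂ Q) (hT : T₁ + T₂ ≤ T) : Runs B (.seq c₁ c₂) s T Q := by
  obtain ⟨t₁, s₁, e₁, l₁, q₁⟩ := h₁
  obtain ⟨t₂, s₂, e₂, l₂, q₂⟩ := h₂ _ q₁
  exact ⟨_, _, .seq e₁ e₂, by omega, q₂⟩

theorem fits {b K : ℕ} (hb : 256 ≤ b) (hB : b ^ K ≤ B) {e : Expr} (hs : s.Bdd b)
    (hl : e.maxLit ≤ 256) (hK : e.cost ≤ K) : e.Fits B s :=
  ((e.eval_le_and_fits (by omega) hs (hl.trans hb)).2).mono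
    ((Nat.pow_le_pow_right (by omega) hK).trans hB)

theorem ite {b K : ℕ} (hb : 256 ≤ b) (hB : b ^ K ≤ B) {e : Expr} {c₁ c₂ : Cmd} (hs : s.Bdd b)
    (hl : e.maxLit ≤ 256) (hK : e.cost ≤ K) {T' : ℕ}
    (h₁ : e.eval s ≠ 0 → Runs B c₁ s T' Q) (h₂ : e.eval s = 0 → Runs B c₂ s T' Q)
    (hT : e.cost + 1 + T' ≤ T) : Runs B (.ite e c₁ c₂) s T Q := by
  by_cases h0 : e.eval s = 0
  · obtain ⟨t, s', h, l, q⟩ := h₂ h0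
    exact ⟨_, s', .ite_false (fits hb hB hs hl hK) h0 h, by omega, q⟩
  · obtain ⟨t, s', h, l, q⟩ := h₁ h0
    exact ⟨_, s', .ite_true (fits hb hB hs hl hK) h0 h, by omega, q⟩

/-- A loop with invariant `Inv` and decreasing measure `φ`. -/
theorem loop {b K : ℕ} (hb : 256 ≤ b) (hB : b ^ K ≤ B) {e : Expr} {c : Cmd}
    (Inv : State → Prop) (φ : State → ℕ) (T' : ℕ) (hl : e.maxLit ≤ 256) (hK : e.cost ≤ K)
    (hbdd : ∀ s, Inv s → s.Bdd b)
    (hbody : ∀ s, Inv s → e.eval s ≠ 0 → Runs B c s T' fun s' => Inv s' ∧ φ s' < φ s)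
    (hs : Inv s) (hT : (T' + e.cost + 1) * (φ s + 1) ≤ T)
    (hQ : ∀ s', Inv s' → e.eval s' = 0 → Q s') : Runs B (.loop e c) s T Q := by
  -- Induction on an upper bound for the measure: every round pays for one factor, and the final
  -- failing test for the last one.
  have key : ∀ m, ∀ s, Inv s → φ s ≤ m → Runs B (.loop e c) s ((T' + e.cost + 1) * (m + 1)) Q := by
    intro m
    induction m with
    | zero =>
      intro s hs hm
      by_cases h0 : e.eval s = 0
      · exact ⟨_, s, .loop_false (fits hb hB (hbdd s hs) hl hK) h0, by omega, hQ s hs h0⟩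
      · obtain ⟨t, s', -, -, -, h⟩ := hbody s hs h0
        omega
    | succ m ih =>
      intro s hs hm
      by_cases h0 : e.eval s = 0
      · exact ⟨_, s, .loop_false (fits hb hB (hbdd s hs) hl hK) h0, by nlinarith, hQ s hs h0⟩
      · obtain ⟨t, s', he, ht, hi, h⟩ := hbody s hs h0
        obtain ⟨t', s'', he', ht', hq⟩ := ih s' hi (by omega)
        refine ⟨_, s'', .loop_true (fits hb hB (hbdd s hs) hl hK) h0 he he', ?_, hq⟩
        calc e.cost + 1 + t + t' ≤ (T' + e.cost + 1) + (T' + e.cost + 1) * (m + 1) := by omega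
          _ = _ := by ring
  exact (key _ s hs le_rfl).mono hT fun _ h => h

end Runs

end WordRAM

/-! ### Memory layout -/

namespace WordRAM

/-- A memory with the input in the cells below `S`, and with eight interleaved arrays above. -/
def lay (S : ℕ) (inp : ℕ → ℕ) (A : ℕ → ℕ → ℕ) : ℕ → ℕ :=
  fun a => if a < S then inp a else A ((a - S) % 8) ((a - S) / 8)

theorem lay_input {S : ℕ} {inp : ℕ → ℕ} {A : ℕ → ℕ → ℕ} {a : ℕ} (h : a < S) :
    lay S inp A a = inp a := if_pos h

theorem lay_array {S : ℕ} {inp : ℕ → ℕ} {A : ℕ → ℕ → ℕ} {k i : ℕ} (h : k < 8) :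
    lay S inp A (S + 8 * i + k) = A k i := by
  have h₁ : ¬ S + 8 * i + k < S := by omega
  have h₂ : (S + 8 * i + k - S) % 8 = k := by omega
  have h₃ : (S + 8 * i + k - S) / 8 = i := by omega
  rw [lay, if_neg h₁, h₂, h₃]

/-- The arrays `A` after the assignment of `v` to cell `i` of array `k`. -/
def setArr (A : ℕ → ℕ → ℕ) (k i v : ℕ) : ℕ → ℕ → ℕ :=
  Function.update A k (Function.update (A k) i v)

theorem setArr_apply (A : ℕ → ℕ → ℕ) (k i v k' i' : ℕ) :
    setArr A k i v k' i' = if k' = k ∧ i' = i then v else A k' i' := by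
  unfold setArr
  by_cases hk : k' = k
  · subst hk
    simp [Function.update_apply]
  · simp [hk]

theorem setArr_same (A : ℕ → ℕ → ℕ) (k i v : ℕ) :
    setArr A k i v k = Function.update (A k) i v := Function.update_self ..

theorem setArr_ne (A : ℕ → ℕ → ℕ) {k k' : ℕ} (h : k' ≠ k) (i v : ℕ) :
    setArr A k i v k' = A k' := Function.update_of_ne h ..

/-- For `k < 8` the address determines `k` as a remainder and `i` as a quotient, so the store
changes a single array cell and never touches the input. -/
theorem update_lay {S : ℕ} {inp : ℕ → ℕ} {A : ℕ → ℕ → ℕ} {k i v : ℕ} (h : k < 8) :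
    Function.update (lay S inp A) (S + 8 * i + k) v = lay S inp (setArr A k i v) := by
  funext a
  rw [Function.update_apply]
  unfold lay
  split_ifs with h₁ h₂ h₂
  · omega
  · have h₃ : (a - S) % 8 = k := by omega
    have h₄ : (a - S) / 8 = i := by omega
    simp [setArr_apply, h₃, h₄]
  · rfl
  · rw [setArr_apply, if_neg (by omega)]

namespace Expr

/-- The address of cell `i` of array `k`. -/
def addr (k : ℕ) (i : Expr) : Expr := .add (.add (.reg 3) (.mul (.lit 8) i)) (.lit k)

/-- Cell `i` of array `k`. -/
def arr (k : ℕ) (i : Expr) : Expr := .mem (addr k i)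

/-- The index of the pair `(a, x)` in an array whose rows have length `n + 1`. -/
def idx (a x : Expr) : Expr := .add (.mul a (.reg 2)) x

theorem eval_addr (k : ℕ) (i : Expr) (s : State) :
    (addr k i).eval s = s.reg 3 + 8 * i.eval s + k := rfl

theorem eval_arr {k : ℕ} {i : Expr} {s : State} {inp : ℕ → ℕ} {A : ℕ → ℕ → ℕ} {S : ℕ}
    (hk : k < 8) (hm : s.mem = lay S inp A) (h3 : s.reg 3 = S) :
    (arr k i).eval s = A k (i.eval s) := by
  change s.mem ((addr k i).eval s) = _
  rw [eval_addr, hm, h3, lay_array hk]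

theorem eval_idx (a x : Expr) (s : State) :
    (idx a x).eval s = a.eval s * s.reg 2 + x.eval s := rfl

end Expr

end WordRAM

/-- Uniqueness of quotient and remainder. It separates the cells of a two-dimensional array, and
also the leading digit of a numeral from the rest. -/
theorem mul_add_inj {m a x a' x' : ℕ} (hx : x < m) (hx' : x' < m) :
    a * m + x = a' * m + x' ↔ a = a' ∧ x = x' := by
  refine ⟨fun h => ?_, fun h => by rw [h.1, h.2]⟩
  have h₁ := congrArg (· / m) h
  have h₂ := congrArg (· % m) h
  have hm : 0 < m := by omega
  simp only [Nat.mul_comm _ m, Nat.mul_add_div hm, Nat.mul_add_mod, Nat.div_eq_of_lt hx,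
    Nat.div_eq_of_lt hx', Nat.mod_eq_of_lt hx, Nat.mod_eq_of_lt hx'] at h₁ h₂
  exact ⟨by simpa using h₁, h₂⟩

/-! ### The words of an instance -/

theorem List.length_flatMap_range (f : ℕ → List ℕ) (m : ℕ) :
    ((List.range m).flatMap f).length = ∑ a ∈ Finset.range m, (f a).length := by
  induction m with
  | zero => rfl
  | succ m ih => simp [List.range_succ, List.flatMap_append, ih, Finset.sum_range_succ]

theorem List.getD_flatMap_range (f : ℕ → List ℕ) {m a j : ℕ} (ha : a < m) (hj : j < (f a).length) :
    ((List.range m).flatMap f).getD ((∑ a' ∈ Finset.range a, (f a').length) + j) 0 =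
      (f a)[j] := by
  induction m with
  | zero => omega
  | succ m ih =>
    rw [List.range_succ, List.flatMap_append]
    rcases Nat.lt_succ_iff_lt_or_eq.1 ha with h | rfl
    · rw [List.getD_append _ _ _ _ ?_, ih h]
      rw [List.length_flatMap_range]
      calc _ < ∑ a' ∈ Finset.range (a + 1), (f a').length := by
            rw [Finset.sum_range_succ]; omega
        _ ≤ _ := Finset.sum_le_sum_of_subset (Finset.range_subset_range.2 h)
    · rw [List.getD_append_right _ _ _ _ (by rw [List.length_flatMap_range]; omega),
        List.length_flatMap_range]
      simp [hj]

theorem List.idxOf_map_val {n : ℕ} (l : List (Fin n)) (x : Fin n) :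
    (l.map Fin.val).idxOf (x : ℕ) = l.idxOf x := by
  induction l with
  | nil => rfl
  | cons y l ih =>
    by_cases h : y = x
    · simp [h]
    · rw [List.map_cons, List.idxOf_cons_ne _ h, List.idxOf_cons_ne _ (Fin.val_ne_of_ne h), ih]

namespace GNSPM

/-- The preference list of agent `a`; the agents are `u_0, …, u_{n-1}, w_0, …, w_{n-1}`. -/
def lst (I : GNSPM) (a : ℕ) : List ℕ :=
  if h : a < I.n then (I.profile.prefU ⟨a, h⟩).map Fin.val
  else if h : a - I.n < I.n then (I.profile.prefW ⟨a - I.n, h⟩).map Fin.val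
  else []

theorem lst_U (I : GNSPM) (u : Fin I.n) : I.lst u = (I.profile.prefU u).map Fin.val := by
  simp [lst]

theorem lst_W (I : GNSPM) (w : Fin I.n) : I.lst (I.n + w) = (I.profile.prefW w).map Fin.val := by
  simp [lst]

theorem nodup_lst (I : GNSPM) (a : ℕ) : (I.lst a).Nodup := by
  unfold lst
  split_ifs
  · exact (I.profile.nodupU _).map Fin.val_injective
  · exact (I.profile.nodupW _).map Fin.val_injective
  · exact List.nodup_nil

theorem lt_of_mem_lst (I : GNSPM) {a x : ℕ} (h : x ∈ I.lst a) : x < I.n := by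
  unfold lst at h
  split_ifs at h
  · obtain ⟨y, -, rfl⟩ := List.mem_map.1 h
    exact y.2
  · obtain ⟨y, -, rfl⟩ := List.mem_map.1 h
    exact y.2
  · simp at h

theorem length_lst_le (I : GNSPM) (a : ℕ) : (I.lst a).length ≤ I.n := by
  have h : (I.lst a) ⊆ List.range I.n := fun x hx => List.mem_range.2 (I.lt_of_mem_lst hx)
  simpa using ((I.nodup_lst a).subperm h).length_le

theorem mem_lst_U (I : GNSPM) (u w : Fin I.n) : (w : ℕ) ∈ I.lst u ↔ w ∈ I.profile.prefU u := by
  rw [lst_U, List.mem_map_of_injective Fin.val_injective]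

theorem mem_lst_W (I : GNSPM) (u w : Fin I.n) :
    (u : ℕ) ∈ I.lst (I.n + w) ↔ u ∈ I.profile.prefW w := by
  rw [lst_W, List.mem_map_of_injective Fin.val_injective]

theorem idxOf_lst_U (I : GNSPM) (u w : Fin I.n) :
    (I.lst u).idxOf (w : ℕ) = I.profile.rkU u w := by
  rw [lst_U, List.idxOf_map_val]; rfl

theorem idxOf_lst_W (I : GNSPM) (u w : Fin I.n) :
    (I.lst (I.n + w)).idxOf (u : ℕ) = I.profile.rkW w u := by
  rw [lst_W, List.idxOf_map_val]; rfl

/-- Both sides are numbered consecutively by `0, …, 2n - 1`, so that one loop can read all lists. -/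
theorem encode_eq (I : GNSPM) : I.encode =
    I.n :: I.d :: (List.range (I.n + I.n)).flatMap fun a => (I.lst a).length :: I.lst a := by
  have h : List.range I.n = (List.finRange I.n).map Fin.val := by simp
  rw [List.range_add, List.flatMap_append, List.flatMap_map, h, List.flatMap_map, List.flatMap_map]
  simp only [encode, encodeList, lst_U, lst_W, List.length_map]

/-- The address of the first word of the list of agent `a`. -/
def offset (I : GNSPM) (a : ℕ) : ℕ := 2 + ∑ a' ∈ Finset.range a, ((I.lst a').length + 1)

theorem offset_succ (I : GNSPM) (a : ℕ) :
    I.offset (a + 1) = I.offset a + (I.lst a).length + 1 := by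
  rw [offset, Finset.sum_range_succ, offset]; omega

theorem size_eq (I : GNSPM) : I.size = I.offset (I.n + I.n) := by
  rw [size, encode_eq, List.length_cons, List.length_cons, List.length_flatMap_range, offset]
  simp only [List.length_cons]; omega

theorem offset_mono (I : GNSPM) : Monotone I.offset :=
  monotone_nat_of_le_succ fun a => by rw [offset_succ]; omega

theorem size_le (I : GNSPM) : I.size ≤ 2 * (I.n + 1) ^ 2 := by
  have h : ∑ a' ∈ Finset.range (I.n + I.n), ((I.lst a').length + 1) ≤ (I.n + I.n) * (I.n + 1) := by
    simpa using Finset.sum_le_card_nsmul (Finset.range (I.n + I.n))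
      (fun a' => (I.lst a').length + 1) (I.n + 1) fun a _ => by simpa using I.length_lst_le a
  rw [size_eq, offset]
  nlinarith

theorem le_size (I : GNSPM) : 2 * I.n + 2 ≤ I.size := by
  have h := Finset.card_nsmul_le_sum (Finset.range (I.n + I.n))
    (fun a' => (I.lst a').length + 1) 1 fun a _ => by simp
  rw [size_eq, offset]
  simp only [Finset.card_range, smul_eq_mul] at h
  omega

/-- The input as a function of the address. -/
def input (I : GNSPM) (i : ℕ) : ℕ := I.encode.getD i 0

theorem input_zero (I : GNSPM) : I.input 0 = I.n := rfl

theorem input_one (I : GNSPM) : I.input 1 = I.d := rfl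

theorem input_offset_add (I : GNSPM) {a j : ℕ} (ha : a < I.n + I.n)
    (hj : j < ((I.lst a).length :: I.lst a).length) :
    I.input (I.offset a + j) = ((I.lst a).length :: I.lst a)[j] := by
  rw [input, encode_eq, ← List.getD_flatMap_range (fun a => (I.lst a).length :: I.lst a) ha hj,
    show I.offset a + j = (∑ a' ∈ Finset.range a, ((I.lst a').length + 1)) + j + 1 + 1 by
      rw [offset]; omega]
  rfl

theorem input_offset (I : GNSPM) {a : ℕ} (ha : a < I.n + I.n) :
    I.input (I.offset a) = (I.lst a).length :=
  I.input_offset_add (j := 0) ha (by simp)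

theorem input_entry (I : GNSPM) {a j : ℕ} (ha : a < I.n + I.n) (hj : j < (I.lst a).length) :
    I.input (I.offset a + j + 1) = (I.lst a)[j] := by
  have := I.input_offset_add (j := j + 1) ha (by simpa using hj)
  simpa [add_assoc] using this

theorem input_eq_zero (I : GNSPM) {i : ℕ} (h : I.size ≤ i) : I.input i = 0 :=
  List.getD_eq_default _ _ h

/-- The arrays begin at `2 * (n + 1) ^ 2`, which is computed from `n` alone, and not at the end of
the input, which is unknown before the lists are read. By `size_le` no input word lies there, and
memory past the input is zero. -/
theorem init_mem (I : GNSPM) :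
    (WordRAM.State.init I.encode).mem =
      WordRAM.lay (2 * (I.n + 1) ^ 2) I.input fun _ _ => 0 := by
  funext i
  change I.input i = _
  unfold WordRAM.lay
  split_ifs with h
  · rfl
  · exact I.input_eq_zero (by have := I.size_le; omega)

theorem input_le (I : GNSPM) (i : ℕ) : I.input i ≤ I.size + I.d := by
  have hsz := I.le_size
  have key : ∀ x ∈ I.encode, x ≤ I.size + I.d := by
    rw [encode_eq]
    intro x hx
    rw [List.mem_cons, List.mem_cons, List.mem_flatMap] at hx
    rcases hx with rfl | rfl | ⟨a, -, hx⟩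
    · omega
    · omega
    · rcases List.mem_cons.1 hx with rfl | hx
      · have := I.length_lst_le a; omega
      · have := I.lt_of_mem_lst hx; omega
  by_cases h : i < I.encode.length
  · rw [input, List.getD_eq_getElem _ _ h]
    exact key _ (List.getElem_mem h)
  · rw [I.input_eq_zero (by rw [size]; omega)]; omega

end GNSPM

/-! ### Reading the input -/

namespace GNSPM

/-- A bound on all numbers that the algorithms store. -/
def bnd (I : GNSPM) : ℕ := (I.size + I.d) ^ 8

theorem le_bnd (I : GNSPM) {x : ℕ} (m : ℕ) (hm : m ≤ 8) (h : x ≤ (I.size + I.d) ^ m) :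
    x ≤ I.bnd :=
  h.trans (Nat.pow_le_pow_right (by have := I.le_size; omega) hm)

theorem le_bnd' (I : GNSPM) {x : ℕ} (h : x ≤ I.size + I.d) : x ≤ I.bnd :=
  I.le_bnd 1 (by omega) (by simpa using h)

/-- This is what the exponent 8 in `bnd` is for, as `size + d` may be just 2. The quantities that
are stored need no more than the fourth power. -/
theorem const_le_bnd (I : GNSPM) : 256 ≤ I.bnd :=
  calc 256 = 2 ^ 8 := by norm_num
    _ ≤ _ := Nat.pow_le_pow_left (by have := I.le_size; omega) 8

/-- One more than the rank of `x` in the list of agent `a`, and `0` if `x` is unacceptable. -/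
def rank (I : GNSPM) (a x : ℕ) : ℕ := if x ∈ I.lst a then (I.lst a).idxOf x + 1 else 0

/-- One more than the `i`-th member of the list of agent `a`, and `0` past the end of the list. -/
def entry (I : GNSPM) (a i : ℕ) : ℕ := if i < (I.lst a).length then (I.lst a).getD i 0 + 1 else 0

end GNSPM

namespace WordRAM

open WordRAM.Expr

/-- The input has been read: the arrays `0` and `1` hold the ranks and the entries of the lists. -/
structure Ready (I : GNSPM) (A : ℕ → ℕ → ℕ) (s : State) : Prop where
  mem : s.mem = lay (2 * (I.n + 1) ^ 2) I.input A
  reg1 : s.reg 1 = I.n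
  reg2 : s.reg 2 = I.n + 1
  reg3 : s.reg 3 = 2 * (I.n + 1) ^ 2
  bdd : s.Bdd I.bnd
  rank : ∀ a < I.n + I.n, ∀ x ≤ I.n, A 0 (a * (I.n + 1) + x) = I.rank a x
  entry : ∀ a < I.n + I.n, ∀ i ≤ I.n, A 1 (a * (I.n + 1) + i) = I.entry a i

/-- The current word of the list that is being read. -/
def readWord : Expr := .mem (.add (.add (.reg 5) (.reg 6)) (.lit 1))

/-- Registers `4` and `6` need no assignment, being `0` initially; the lists begin at address `2`,
after `n` and `d`. -/
def readSetup : Cmd :=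
  .seq (.assign 1 (.mem (.lit 0)))
  (.seq (.assign 2 (.add (.reg 1) (.lit 1)))
  (.seq (.assign 3 (.mul (.lit 2) (.mul (.reg 2) (.reg 2))))
  (.assign 5 (.lit 2))))

/-- Register `4` is the agent whose list is read, register `5` the address of this list, and
register `6` the number of entries read so far. -/
def readBody : Cmd :=
  .ite (.lt (.reg 6) (.mem (.reg 5)))
    (.seq (.store (addr 0 (idx (.reg 4) readWord)) (.add (.reg 6) (.lit 1)))
      (.seq (.store (addr 1 (idx (.reg 4) (.reg 6))) (.add readWord (.lit 1)))
        (.assign 6 (.add (.reg 6) (.lit 1)))))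
    (.seq (.assign 5 (.add (.add (.reg 5) (.mem (.reg 5))) (.lit 1)))
      (.seq (.assign 6 (.lit 0)) (.assign 4 (.add (.reg 4) (.lit 1)))))

def readAll : Cmd :=
  .seq readSetup (.loop (.lt (.reg 4) (.add (.reg 1) (.reg 1))) readBody)

/-- For `x` outside the list, `idxOf x` is the length and never below `j`; its cell stays `0`, which
is the rank of an unacceptable agent. The field `rest` is kept so that the later phases start from
zero arrays. -/
structure ReadInv (I : GNSPM) (A : ℕ → ℕ → ℕ) (a j : ℕ) (s : State) : Prop where
  mem : s.mem = lay (2 * (I.n + 1) ^ 2) I.input A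
  reg1 : s.reg 1 = I.n
  reg2 : s.reg 2 = I.n + 1
  reg3 : s.reg 3 = 2 * (I.n + 1) ^ 2
  reg4 : s.reg 4 = a
  reg5 : s.reg 5 = I.offset a
  reg6 : s.reg 6 = j
  zero : s.reg 0 = 0
  zeros : ∀ x, 6 < x → s.reg x = 0
  bdd : s.Bdd I.bnd
  ale : a ≤ I.n + I.n
  jle : j ≤ (I.lst a).length
  rank : ∀ a' < I.n + I.n, ∀ x ≤ I.n, A 0 (a' * (I.n + 1) + x) =
    if a' < a ∨ (a' = a ∧ (I.lst a').idxOf x < j) then I.rank a' x else 0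
  entry : ∀ a' < I.n + I.n, ∀ i ≤ I.n, A 1 (a' * (I.n + 1) + i) =
    if a' < a ∨ (a' = a ∧ i < j) then I.entry a' i else 0
  rest : ∀ k, 2 ≤ k → A k = fun _ => 0

theorem readBody_runs {I : GNSPM} {B : ℕ} (hB : I.bnd ^ 1000 ≤ B) {A : ℕ → ℕ → ℕ} {a j : ℕ}
    {s : State} (h : ReadInv I A a j s) (ha : a < I.n + I.n) :
    Runs B readBody s readBody.cost fun s' =>
      ∃ A' a' j', ReadInv I A' a' j' s' ∧ I.offset a' + j' = I.offset a + j + 1 := by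
  have hoff : I.offset a + (I.lst a).length + 1 ≤ I.size := by
    rw [I.size_eq, ← I.offset_succ]; exact I.offset_mono ha
  have hsz := I.size_le
  have hjle := h.jle
  have hlen := I.length_lst_le a
  have e5 : s.mem (I.offset a) = (I.lst a).length := by
    rw [h.mem, lay_input (by omega), I.input_offset ha]
  by_cases hj : j < (I.lst a).length
  · have e56 : s.mem (I.offset a + j + 1) = (I.lst a)[j] := by
      rw [h.mem, lay_input (by omega), I.input_entry ha hj]
    have hx : (I.lst a)[j] < I.n := I.lt_of_mem_lst (List.getElem_mem hj)
    -- The current word is read once more after the first store; that store lies above the input and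
    -- does not change it.
    have e56' : Function.update s.mem
        (2 * (I.n + 1) ^ 2 + 8 * (a * (I.n + 1) + (I.lst a)[j])) (j + 1) (I.offset a + j + 1)
        = (I.lst a)[j] := by
      rw [Function.update_of_ne (by omega), e56]
    refine Runs.straight I.const_le_bnd hB h.bdd ?_ (by decide) (by decide) le_rfl fun hbd => ?_
    · simp [readBody, readWord, Cmd.Bounded, Cmd.result, eval, eval_addr, eval_idx, h.reg2, h.reg3,
        h.reg4, h.reg5, h.reg6, e5, e56, e56', hj]
      have := I.le_size
      exact ⟨I.le_bnd' (by omega), I.le_bnd' (by omega), I.le_bnd' (by omega)⟩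
    · refine ⟨setArr (setArr A 0 (a * (I.n + 1) + (I.lst a)[j]) (j + 1)) 1
        (a * (I.n + 1) + j) ((I.lst a)[j] + 1), a, j + 1, ?_, by omega⟩
      refine ⟨?_, ?_, ?_, ?_, ?_, ?_, ?_, ?_, ?_, hbd, ha.le, hj, ?_, ?_, ?_⟩
      · simp only [readBody, readWord, Cmd.result, eval, eval_addr, eval_idx, h.reg2, h.reg3,
          h.reg4, h.reg5, h.reg6, e5, e56, e56', hj, if_true, one_ne_zero, if_false, add_zero]
        rw [h.mem, ← update_lay (by omega), ← update_lay (by omega)]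
        rfl
      all_goals try
        simp [readBody, readWord, Cmd.result, eval, h.reg1, h.reg2, h.reg3, h.zero,
          h.reg4, h.reg5, h.reg6, e5, hj]
      · intro x hx
        rw [Function.update_of_ne (by omega), h.zeros x hx]
      · intro a' ha' x hx
        rw [setArr_ne _ (by omega), setArr_apply, h.rank a' ha' x hx]
        simp only [mul_add_inj (show x < I.n + 1 by omega) (show (I.lst a)[j] < I.n + 1 by omega)]
        rcases lt_trichotomy a' a with h' | rfl | h'
        · simp [h', h'.ne]
        · by_cases hxj : x = (I.lst a')[j]
          · subst hxj
            simp [GNSPM.rank, (I.nodup_lst a').idxOf_getElem j hj]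
          · have hne : (I.lst a').idxOf x ≠ j := by
              rintro rfl
              exact hxj (List.getElem_idxOf hj).symm
            have hiff : (I.lst a').idxOf x ≤ j ↔ (I.lst a').idxOf x < j := by omega
            simp [hxj, hiff]
        · simp [h'.ne', not_lt.2 h'.le]
      · intro a' ha' i hi
        rw [setArr_apply, setArr_ne _ (by omega), h.entry a' ha' i hi]
        simp only [mul_add_inj (show i < I.n + 1 by omega) (show j < I.n + 1 by omega)]
        rcases lt_trichotomy a' a with h' | rfl | h'
        · simp [h', h'.ne]
        · by_cases hij : i = j
          · subst hij
            simp [GNSPM.entry, hj]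
          · have hiff : i ≤ j ↔ i < j := by omega
            simp [hij, hiff]
        · simp [h'.ne', not_lt.2 h'.le]
      · intro k hk
        rw [setArr_ne _ (by omega), setArr_ne _ (by omega), h.rest k hk]
  · refine Runs.straight I.const_le_bnd hB h.bdd ?_ (by decide) (by decide) le_rfl fun hbd => ?_
    · simp [readBody, Cmd.Bounded, Cmd.result, eval, h.reg4, h.reg5, h.reg6, e5, hj]
      have := I.le_size
      exact ⟨I.le_bnd' (by omega), I.le_bnd' (by omega)⟩
    · refine ⟨A, a + 1, 0, ?_, by rw [I.offset_succ]; omega⟩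
      refine ⟨?_, ?_, ?_, ?_, ?_, ?_, ?_, ?_, ?_, hbd, ha, Nat.zero_le _, ?_, ?_, h.rest⟩
      all_goals try
        simp [readBody, readWord, Cmd.result, eval, h.reg1, h.reg2, h.reg3, h.zero, h.mem,
          h.reg4, h.reg5, h.reg6, e5, hj]
      · rw [I.offset_succ]
      · intro x hx
        rw [Function.update_of_ne (by omega), Function.update_of_ne (by omega),
          Function.update_of_ne (by omega), h.zeros x hx]
      · intro a' ha' x hx
        rw [h.rank a' ha' x hx]
        rcases lt_trichotomy a' a with h' | rfl | h'
        · simp [h', h'.le]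
        · by_cases hm : x ∈ I.lst a'
          · have := List.idxOf_lt_length_iff.2 hm
            simp [show (I.lst a').idxOf x < j by omega]
          · simp [GNSPM.rank, hm]
        · simp [h'.ne', not_lt.2 h'.le, h']
      · intro a' ha' i hi
        rw [h.entry a' ha' i hi]
        rcases lt_trichotomy a' a with h' | rfl | h'
        · simp [h', h'.le]
        · by_cases hm : i < (I.lst a').length
          · simp [show i < j by omega]
          · simp [GNSPM.entry, hm]
        · simp [h'.ne', not_lt.2 h'.le, h']

/-- Each round advances `offset a + j` by exactly one, whether it reads an entry or passes to the
next list. This sum starts at `2` and is bounded by the size, whence the linear time. -/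
theorem readAll_runs {I : GNSPM} {B : ℕ} (hB : I.bnd ^ 1000 ≤ B) :
    Runs B readAll (.init I.encode) (100 * I.size) fun s =>
      ∃ A, Ready I A s ∧ s.reg 0 = 0 ∧ (∀ x, 6 < x → s.reg x = 0) ∧
        ∀ k, 2 ≤ k → A k = fun _ => 0 := by
  have hsz := I.le_size
  have hn : 2 * (I.n + 1) ^ 2 ≤ (I.size + I.d) ^ 2 := by
    have : (2 * (I.n + 1)) ^ 2 ≤ (I.size + I.d) ^ 2 := Nat.pow_le_pow_left (by omega) 2
    nlinarith
  have e0 : (State.init I.encode).mem 0 = I.n := I.input_zero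
  have hreg : ∀ x, (State.init I.encode).reg x = 0 := fun _ => rfl
  refine Runs.seq (Q₁ := fun s => ∃ A a j, ReadInv I A a j s ∧ I.offset a + j = 2) (T₁ := 20)
    (T₂ := 99 * I.size - 20) ?_ ?_ (by omega)
  · refine Runs.straight I.const_le_bnd hB ?_ ?_ (by decide) (by decide) (by decide) fun hbd => ?_
    · exact ⟨fun x => Nat.zero_le _, fun a => I.le_bnd' (I.input_le a)⟩
    · simp [readSetup, Cmd.Bounded, Cmd.result, eval, e0]
      exact ⟨I.le_bnd' (by omega), I.le_bnd' (by omega), I.le_bnd 2 (by omega) (by linarith),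
        I.le_bnd' (by omega)⟩
    · refine ⟨fun _ _ => 0, 0, 0, ?_, rfl⟩
      refine ⟨?_, ?_, ?_, ?_, ?_, ?_, ?_, ?_, ?_, hbd, Nat.zero_le _, Nat.zero_le _, ?_, ?_, ?_⟩
      · exact I.init_mem
      all_goals try
        simp [readSetup, Cmd.result, eval, e0, hreg, GNSPM.offset]
      · ring
      · intro x hx
        repeat rw [Function.update_of_ne (by omega)]
        exact hreg x
  · rintro s₁ ⟨A, a, j, hinv, h2⟩
    have h5 : s₁.reg 5 + s₁.reg 6 = 2 := by rw [hinv.reg5, hinv.reg6, h2]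
    refine Runs.loop I.const_le_bnd hB (fun s => ∃ A a j, ReadInv I A a j s)
      (fun s => I.size - (s.reg 5 + s.reg 6)) readBody.cost (by decide) (by decide)
      (fun s ⟨A, a, j, h⟩ => h.bdd) ?_ ⟨A, a, j, hinv⟩ ?_ ?_
    · rintro s ⟨A, a, j, h⟩ hv
      have ha : a < I.n + I.n := by
        by_contra hcon
        simp [eval, h.reg4, h.reg1, hcon] at hv
      refine (readBody_runs hB h ha).mono le_rfl ?_
      rintro s' ⟨A', a', j', h', heq⟩
      refine ⟨⟨A', a', j', h'⟩, ?_⟩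
      have hoff : I.offset a + (I.lst a).length + 1 ≤ I.size := by
        rw [I.size_eq, ← I.offset_succ]; exact I.offset_mono ha
      have := h.jle
      simp only [h.reg5, h.reg6, h'.reg5, h'.reg6]
      omega
    · have : readBody.cost + (Expr.lt (.reg 4) (.add (.reg 1) (.reg 1))).cost + 1 ≤ 80 := by decide
      simp only [h5]
      nlinarith [Nat.sub_add_cancel (show 20 ≤ 99 * I.size by omega),
        Nat.sub_add_cancel (show 2 ≤ I.size by omega)]
    · rintro s ⟨A, a, j, h⟩ hv
      have ha : a = I.n + I.n := by
        by_contra hcon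
        have := h.ale
        simp [eval, h.reg4, h.reg1, show a < I.n + I.n by omega] at hv
      refine ⟨A, ⟨h.mem, h.reg1, h.reg2, h.reg3, h.bdd, ?_, ?_⟩, h.zero, h.zeros, h.rest⟩
      · intro a' ha' x hx
        rw [h.rank a' ha' x hx, if_pos (by omega)]
      · intro a' ha' i hi
        rw [h.entry a' ha' i hi, if_pos (by omega)]

end WordRAM

/-! ### Deferred acceptance -/

/-- The invariant of deferred acceptance. The agents `u ≤ i` have started to propose; all of them
but `cur` are engaged or have been rejected by everybody in their list; `pos u` is the number of
proposals of `u`, `mt w = u + 1` if `w` is engaged to `u`, and `cnt` counts the engagements. -/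
structure DeferredInv (I : GNSPM) (pos mt : ℕ → ℕ) (i cur cnt : ℕ) : Prop where
  ile : i ≤ I.n
  cle : cur ≤ i
  clast : i = I.n → cur = I.n
  posle : ∀ u < I.n, pos u ≤ (I.lst u).length
  held : ∀ w u, mt w = u + 1 → u ≤ i ∧ u ≠ cur ∧ u < I.n ∧ w < I.n ∧ u ∈ I.lst (I.n + w) ∧
    ∃ j, pos u = j + 1 ∧ (I.lst u)[j]? = some w
  proposed : ∀ u < I.n, ∀ j < pos u, ∀ w, (I.lst u)[j]? = some w → u ∈ I.lst (I.n + w) →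
    ∃ v, mt w = v + 1 ∧ (I.lst (I.n + w)).idxOf v ≤ (I.lst (I.n + w)).idxOf u
  settled : ∀ u ≤ i, u < I.n → u ≠ cur → (∃ w, mt w = u + 1) ∨ pos u = (I.lst u).length
  count : cnt = ((Finset.range I.n).filter fun w => mt w ≠ 0).card

namespace DeferredInv

variable {I : GNSPM} {pos mt : ℕ → ℕ} {i cur cnt : ℕ}

theorem init (I : GNSPM) : DeferredInv I (fun _ => 0) (fun _ => 0) 0 0 0 where
  ile := Nat.zero_le _
  cle := le_rfl
  clast h := h
  posle _ _ := Nat.zero_le _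
  held _ _ h := by simp at h
  proposed _ _ _ h := by simp at h
  settled u h _ h' := by omega
  count := by simp

theorem exhausted (h : DeferredInv I pos mt i cur cnt) (hi : i < I.n)
    (hp : pos cur = (I.lst cur).length) : DeferredInv I pos mt (i + 1) (i + 1) cnt where
  ile := hi
  cle := le_rfl
  clast h := h
  posle := h.posle
  held w u hw := by
    obtain ⟨h₁, h₂, h₃⟩ := h.held w u hw
    exact ⟨by omega, by omega, h₃⟩
  proposed := h.proposed
  settled u hu hn hne := by
    by_cases huc : u = cur
    · exact Or.inr (huc ▸ hp)
    · exact h.settled u (by omega) hn huc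
  count := h.count

/-- Covers both kinds of rejection: if `w` does not accept `cur`, the second hypothesis is vacuous.
-/
theorem rejected (h : DeferredInv I pos mt i cur cnt) {w : ℕ}
    (hp : (I.lst cur)[pos cur]? = some w)
    (hw : cur ∈ I.lst (I.n + w) →
      ∃ v, mt w = v + 1 ∧ (I.lst (I.n + w)).idxOf v ≤ (I.lst (I.n + w)).idxOf cur) :
    DeferredInv I (Function.update pos cur (pos cur + 1)) mt i cur cnt where
  ile := h.ile
  cle := h.cle
  clast := h.clast
  posle u hu := by
    rw [Function.update_apply]
    split_ifs with huc
    · subst huc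
      obtain ⟨hlt, -⟩ := List.getElem?_eq_some_iff.1 hp
      exact hlt
    · exact h.posle u hu
  held w' u hw' := by
    obtain ⟨h₁, h₂, h₃, h₄, h₅, h₆⟩ := h.held w' u hw'
    refine ⟨h₁, h₂, h₃, h₄, h₅, ?_⟩
    rwa [Function.update_of_ne h₂]
  proposed u hu j hj w' hj' hacc := by
    rw [Function.update_apply] at hj
    split_ifs at hj with huc
    · subst huc
      rcases Nat.lt_succ_iff_lt_or_eq.1 hj with hlt | rfl
      · exact h.proposed u hu j hlt w' hj' hacc
      · obtain rfl : w = w' := by rw [hp] at hj'; exact Option.some.inj hj'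
        exact hw hacc
    · exact h.proposed u hu j hj w' hj' hacc
  settled u hu hn hne := by
    rw [Function.update_of_ne hne]
    exact h.settled u hu hn hne
  count := h.count

/-- By `proposed`, a free `w` has had no proposal from an agent acceptable to it. The engagement
displaces nobody, and the next agent of `U` starts. -/
theorem accepted (h : DeferredInv I pos mt i cur cnt) (hi : i < I.n) {w : ℕ}
    (hp : (I.lst cur)[pos cur]? = some w) (hacc : cur ∈ I.lst (I.n + w)) (hw : mt w = 0) :
    DeferredInv I (Function.update pos cur (pos cur + 1)) (Function.update mt w (cur + 1))
      (i + 1) (i + 1) (cnt + 1) := by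
  obtain ⟨hlt, hget⟩ := List.getElem?_eq_some_iff.1 hp
  have hwn : w < I.n := I.lt_of_mem_lst (hget ▸ List.getElem_mem hlt)
  have hcle := h.cle
  refine ⟨hi, le_rfl, fun h => h, ?_, ?_, ?_, ?_, ?_⟩
  · intro u hu
    rw [Function.update_apply]
    split_ifs with huc
    · subst huc; exact hlt
    · exact h.posle u hu
  · intro w' u hw'
    rw [Function.update_apply] at hw'
    split_ifs at hw' with hww
    · obtain rfl : cur = u := by omega
      subst hww
      exact ⟨by omega, by omega, by omega, hwn, hacc, pos cur, by simp, hp⟩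
    · obtain ⟨h₁, h₂, h₃, h₄, h₅, h₆⟩ := h.held w' u hw'
      refine ⟨by omega, by omega, h₃, h₄, h₅, ?_⟩
      rwa [Function.update_of_ne h₂]
  · intro u hu j hj w' hj' hacc'
    by_cases hww : w' = w
    · subst hww
      by_cases huc : u = cur
      · exact ⟨cur, by simp, by rw [huc]⟩
      · rw [Function.update_of_ne huc] at hj
        obtain ⟨v, hv, -⟩ := h.proposed u hu j hj w' hj' hacc'
        omega
    · rw [Function.update_of_ne hww]
      by_cases huc : u = cur
      · subst huc
        rw [Function.update_self] at hj
        rcases Nat.lt_succ_iff_lt_or_eq.1 hj with hlt | rfl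
        · exact h.proposed u hu j hlt w' hj' hacc'
        · rw [hp] at hj'
          exact absurd (Option.some.inj hj').symm hww
      · rw [Function.update_of_ne huc] at hj
        exact h.proposed u hu j hj w' hj' hacc'
  · intro u hu hn hne
    by_cases huc : u = cur
    · exact Or.inl ⟨w, by simp [huc]⟩
    · rw [Function.update_of_ne huc]
      refine (h.settled u (by omega) hn huc).imp (fun ⟨w', hw'⟩ => ⟨w', ?_⟩) id
      rw [Function.update_of_ne ?_, hw']
      rintro rfl
      omega
  · have : ((Finset.range I.n).filter fun w' => Function.update mt w (cur + 1) w' ≠ 0) =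
        insert w ((Finset.range I.n).filter fun w => mt w ≠ 0) := by
      ext w'
      by_cases hww : w' = w
      · subst hww; simp [hwn]
      · simp [hww]
    rw [this, Finset.card_insert_of_notMem (by simp [hw]), h.count]

/-- The displaced `v` becomes the proposer and continues after `w` in its list. The partner of `w`
only improves, so earlier proposals that `w` turned down remain worse than the current one. -/
theorem replaced (h : DeferredInv I pos mt i cur cnt) (hi : i < I.n) {w v : ℕ}
    (hp : (I.lst cur)[pos cur]? = some w) (hacc : cur ∈ I.lst (I.n + w)) (hw : mt w = v + 1)
    (hv : (I.lst (I.n + w)).idxOf cur < (I.lst (I.n + w)).idxOf v) :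
    DeferredInv I (Function.update pos cur (pos cur + 1)) (Function.update mt w (cur + 1))
      i v cnt := by
  obtain ⟨hlt, hget⟩ := List.getElem?_eq_some_iff.1 hp
  have hwn : w < I.n := I.lt_of_mem_lst (hget ▸ List.getElem_mem hlt)
  have hcle := h.cle
  obtain ⟨hvi, hvc, hvn, -, -, jv, hjv, hjv'⟩ := h.held w v hw
  refine ⟨h.ile, hvi, fun h => by omega, ?_, ?_, ?_, ?_, ?_⟩
  · intro u hu
    rw [Function.update_apply]
    split_ifs with huc
    · subst huc; exact hlt
    · exact h.posle u hu
  · intro w' u hw'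
    rw [Function.update_apply] at hw'
    split_ifs at hw' with hww
    · obtain rfl : cur = u := by omega
      subst hww
      exact ⟨by omega, by omega, by omega, hwn, hacc, pos cur, by simp, hp⟩
    · obtain ⟨h₁, h₂, h₃, h₄, h₅, j, h₆, h₇⟩ := h.held w' u hw'
      refine ⟨by omega, ?_, h₃, h₄, h₅, ?_⟩
      · rintro rfl
        -- An engaged agent is held by the target of its last proposal, so `v` cannot be held by
        -- both `w` and `w'`.
        obtain rfl : jv = j := by omega
        rw [h₇] at hjv'
        exact hww (Option.some.inj hjv')
      · rw [Function.update_of_ne h₂]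
        exact ⟨j, h₆, h₇⟩
  · intro u hu j hj w' hj' hacc'
    by_cases hww : w' = w
    · subst hww
      refine ⟨cur, by simp, ?_⟩
      by_cases huc : u = cur
      · rw [huc]
      · rw [Function.update_of_ne huc] at hj
        obtain ⟨v', hv', hle⟩ := h.proposed u hu j hj w' hj' hacc'
        obtain rfl : v = v' := by omega
        omega
    · rw [Function.update_of_ne hww]
      by_cases huc : u = cur
      · subst huc
        rw [Function.update_self] at hj
        rcases Nat.lt_succ_iff_lt_or_eq.1 hj with hlt | rfl
        · exact h.proposed u hu j hlt w' hj' hacc'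
        · rw [hp] at hj'
          exact absurd (Option.some.inj hj').symm hww
      · rw [Function.update_of_ne huc] at hj
        exact h.proposed u hu j hj w' hj' hacc'
  · intro u hu hn hne
    by_cases huc : u = cur
    · exact Or.inl ⟨w, by simp [huc]⟩
    · rw [Function.update_of_ne huc]
      refine (h.settled u (by omega) hn huc).imp (fun ⟨w', hw'⟩ => ⟨w', ?_⟩) id
      rw [Function.update_of_ne ?_, hw']
      rintro rfl
      omega
  · have : ((Finset.range I.n).filter fun w' => Function.update mt w (cur + 1) w' ≠ 0) =
        ((Finset.range I.n).filter fun w => mt w ≠ 0) := by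
      ext w'
      by_cases hww : w' = w
      · subst hww; simp [hw]
      · simp [hww]
    rw [this, h.count]

/-- At the end the engagements form a stable matching. -/
theorem exists_stable (h : DeferredInv I pos mt I.n cur cnt) :
    ∃ M, I.profile.IsStable M ∧ M.card = cnt := by
  -- The proposer is now `n`, which is not an agent, so `settled` applies to every agent of `U`.
  have hcur := h.clast rfl
  let M : Finset (Fin I.n × Fin I.n) := Finset.univ.filter fun p => mt p.2 = (p.1 : ℕ) + 1
  have hM : ∀ u w : Fin I.n, (u, w) ∈ M ↔ mt w = (u : ℕ) + 1 := by simp [M]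
  have hinj : ∀ p ∈ M, ∀ q ∈ M, p.2 = q.2 → p = q := by
    rintro ⟨u, w⟩ hp ⟨u', w'⟩ hq (rfl : w = w')
    rw [hM] at hp hq
    ext
    · simp; omega
    · rfl
  refine ⟨M, ⟨⟨?_, ?_⟩, ?_⟩, ?_⟩
  · rintro ⟨u, w⟩ hp
    obtain ⟨-, -, -, -, h₅, j, -, h₇⟩ := h.held w u ((hM _ _).1 hp)
    refine ⟨(I.mem_lst_U u w).1 (List.mem_of_getElem? h₇), (I.mem_lst_W u w).1 h₅⟩
  · rintro p hp q hq hpq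
    refine ⟨fun heq => hpq ?_, fun heq => hpq (hinj p hp q hq heq)⟩
    obtain ⟨u, w⟩ := p
    obtain ⟨u', w'⟩ := q
    obtain rfl : u = u' := heq
    obtain ⟨-, -, -, -, -, j, h₆, h₇⟩ := h.held w u ((hM _ _).1 hp)
    obtain ⟨-, -, -, -, -, j', h₆', h₇'⟩ := h.held w' u ((hM _ _).1 hq)
    obtain rfl : j = j' := by omega
    rw [h₇] at h₇'
    exact hinj _ hp _ hq (Fin.ext (Option.some.inj h₇'))
  · rintro u w ⟨⟨hu, hw⟩, hnot, hbu, hbw⟩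
    have hu' := (I.mem_lst_U u w).2 hu
    have hidx := List.idxOf_lt_length_iff.2 hu'
    -- `u` must have proposed to `w`: if `u` is engaged, its partner is its last proposal and comes
    -- after `w` in the list; otherwise the whole list is used up.
    have hprop : (I.lst u).idxOf (w : ℕ) < pos u := by
      rcases h.settled u u.2.le u.2 (by omega) with ⟨w', hw'⟩ | hlen
      · obtain ⟨-, -, -, hlt, -, j, h₆, h₇⟩ := h.held w' u hw'
        have := hbu ⟨w', hlt⟩ ((hM _ _).2 hw')
        rw [← I.idxOf_lst_U, ← I.idxOf_lst_U] at this
        obtain ⟨hj, hj'⟩ := List.getElem?_eq_some_iff.1 h₇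
        have : (I.lst u).idxOf w' = j := by rw [← hj', (I.nodup_lst u).idxOf_getElem j hj]
        simp only at *
        omega
      · omega
    obtain ⟨v, hv, hle⟩ := h.proposed u u.2 _ hprop w
      (by rw [List.getElem?_eq_getElem hidx, List.getElem_idxOf]) ((I.mem_lst_W u w).2 hw)
    obtain ⟨-, -, hvn, -⟩ := h.held w v hv
    have := hbw ⟨v, hvn⟩ ((hM _ _).2 hv)
    rw [← I.idxOf_lst_W, ← I.idxOf_lst_W] at this
    simp only at this
    omega
  · rw [h.count]
    refine Finset.card_bij (fun p _ => (p.2 : ℕ)) ?_ ?_ ?_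
    · rintro ⟨u, w⟩ hp
      have := (hM _ _).1 hp
      simp [this]
    · intro p hp q hq heq
      exact hinj p hp q hq (Fin.ext heq)
    · intro w hw
      rw [Finset.mem_filter, Finset.mem_range] at hw
      obtain ⟨u, hu⟩ := Nat.exists_eq_succ_of_ne_zero hw.2
      obtain ⟨-, -, hun, -⟩ := h.held w u hu
      exact ⟨(⟨u, hun⟩, ⟨w, hw.1⟩), (hM _ _).2 hu, rfl⟩

end DeferredInv

namespace WordRAM

open WordRAM.Expr

section Layout

variable {S : ℕ} {inp : ℕ → ℕ} {A : ℕ → ℕ → ℕ} {ρ : ℕ → ℕ} {k : ℕ}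

theorem eval_arr_lay {i : Expr} (hk : k < 8) (h3 : ρ 3 = S) :
    (arr k i).eval ⟨ρ, lay S inp A⟩ = A k (i.eval ⟨ρ, lay S inp A⟩) := eval_arr hk rfl h3

theorem result_store_lay {i e : Expr} (hk : k < 8) (h3 : ρ 3 = S) :
    (Cmd.store (addr k i) e).result ⟨ρ, lay S inp A⟩ =
      ⟨ρ, lay S inp (setArr A k (i.eval ⟨ρ, lay S inp A⟩) (e.eval ⟨ρ, lay S inp A⟩))⟩ := by
  simp only [Cmd.result, eval_addr, h3, update_lay hk]

theorem result_seq (c₁ c₂ : Cmd) (s : State) :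
    (Cmd.seq c₁ c₂).result s = c₂.result (c₁.result s) := rfl

theorem result_assign_mk (x : ℕ) (e : Expr) (m : ℕ → ℕ) :
    (Cmd.assign x e).result ⟨ρ, m⟩ = ⟨Function.update ρ x (e.eval ⟨ρ, m⟩), m⟩ := rfl

theorem result_ite (e : Expr) (c₁ c₂ : Cmd) (s : State) :
    (Cmd.ite e c₁ c₂).result s = if e.eval s = 0 then c₂.result s else c₁.result s := rfl

theorem result_skip (s : State) : Cmd.skip.result s = s := rfl

end Layout

/-! ### The program for deferred acceptance -/

/-- Start with the next agent of `U`. -/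
def nextAgent : Cmd := .seq (.assign 7 (.add (.reg 7) (.lit 1))) (.assign 8 (.reg 7))

/-- One more than the next agent in the list of the agent in register `8`. -/
def nextChoice : Expr := arr 1 (idx (.reg 8) (arr 3 (.reg 8)))

/-- The rank of the agent `x` for the agent of `W` in register `16`. -/
def rankFor (x : Expr) : Expr := arr 0 (idx (.add (.reg 1) (.reg 16)) x)

def engage : Cmd := .store (addr 4 (.reg 16)) (.add (.reg 8) (.lit 1))

/-- The agent in register `8` proposes to the next agent in its list. -/
def propose : Cmd :=
  .ite nextChoice
    (.seq (.assign 16 (.sub nextChoice (.lit 1)))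
    (.seq (.store (addr 3 (.reg 8)) (.add (arr 3 (.reg 8)) (.lit 1)))
      (.ite (rankFor (.reg 8))
        (.ite (arr 4 (.reg 16))
          (.ite (.lt (rankFor (.reg 8)) (rankFor (.sub (arr 4 (.reg 16)) (.lit 1))))
            (.seq (.assign 17 (arr 4 (.reg 16)))
              (.seq engage (.assign 8 (.sub (.reg 17) (.lit 1)))))
            .skip)
          (.seq engage (.seq (.assign 9 (.add (.reg 9) (.lit 1))) nextAgent)))
        .skip)))
    nextAgent

def deferredAcceptance : Cmd := .loop (.lt (.reg 7) (.reg 1)) propose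

structure DeferredState (I : GNSPM) (A : ℕ → ℕ → ℕ) (s : State) : Prop where
  ready : Ready I A s
  inv : DeferredInv I (A 3) (A 4) (s.reg 7) (s.reg 8) (s.reg 9)
  cert : A 2 = fun _ => 0
  zero : s.reg 0 = 0

/-- The number of proposals and agents still to be processed. -/
def remaining (I : GNSPM) (pos : ℕ → ℕ) (i : ℕ) : ℕ :=
  (∑ u ∈ Finset.range I.n, ((I.lst u).length - pos u)) + (I.n - i)

theorem remaining_update_lt {I : GNSPM} {pos : ℕ → ℕ} {i i' u : ℕ} (hu : u < I.n)
    (hp : pos u < (I.lst u).length) (hi : i ≤ i') :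
    remaining I (Function.update pos u (pos u + 1)) i' < remaining I pos i := by
  refine Nat.add_lt_add_of_lt_of_le (Finset.sum_lt_sum (fun v _ => ?_)
    ⟨u, Finset.mem_range.2 hu, ?_⟩) (by omega)
  · rw [Function.update_apply]
    split_ifs with h
    · subst h; omega
    · exact le_rfl
  · rw [Function.update_self]; omega

/-- There are five outcomes: the list is exhausted, or `w` is free, prefers the proposer, keeps its
partner, or finds the proposer unacceptable. Each is executed symbolically and matched with a lemma
on `DeferredInv`; each uses up a list entry or starts a new agent. -/
theorem propose_runs {I : GNSPM} {B : ℕ} (hB : I.bnd ^ 1000 ≤ B) {A : ℕ → ℕ → ℕ} {s : State}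
    (h : DeferredState I A s) (hi : s.reg 7 < I.n) :
    Runs B propose s propose.cost fun s' => ∃ A', DeferredState I A' s' ∧
      remaining I (A' 3) (s'.reg 7) < remaining I (A 3) (s.reg 7) := by
  obtain ⟨ρ, m⟩ := s
  obtain ⟨⟨hm, h1, h2, h3, hbdd, hR, hT⟩, hinv, hcert, hzero⟩ := h
  simp only at hm h1 h2 h3 hinv hzero hi
  subst hm
  have hcle := hinv.cle
  have hsz := I.le_size
  have hcur : ρ 8 < I.n := by omega
  have hpos := hinv.posle _ hcur
  have hlen := I.length_lst_le (ρ 8)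
  have hT' := hT (ρ 8) (by omega) (A 3 (ρ 8)) (by omega)
  have hcnt : ρ 9 ≤ I.n := by
    rw [hinv.count]; simpa using Finset.card_filter_le (Finset.range I.n) fun w => A 4 w ≠ 0
  have b1 : A 3 (ρ 8) + 1 ≤ I.bnd := I.le_bnd' (by omega)
  have b2 : ρ 8 + 1 ≤ I.bnd := I.le_bnd' (by omega)
  have b3 : ρ 9 + 1 ≤ I.bnd := I.le_bnd' (by omega)
  have b4 : ρ 7 + 1 ≤ I.bnd := I.le_bnd' (by omega)
  by_cases hex : A 3 (ρ 8) < (I.lst (ρ 8)).length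
  · set w := (I.lst (ρ 8))[A 3 (ρ 8)] with hwdef
    have hp : (I.lst (ρ 8))[A 3 (ρ 8)]? = some w := List.getElem?_eq_getElem hex
    have hw : w < I.n := I.lt_of_mem_lst (List.getElem_mem hex)
    have hTw : A 1 (ρ 8 * (I.n + 1) + A 3 (ρ 8)) = w + 1 := by
      rw [hT', GNSPM.entry, if_pos hex, List.getD_eq_getElem _ _ hex]
    have hRc := hR (I.n + w) (by omega) (ρ 8) (by omega)
    have b5 : w ≤ I.bnd := I.le_bnd' (by omega)
    by_cases hacc : ρ 8 ∈ I.lst (I.n + w)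
    · rw [GNSPM.rank, if_pos hacc] at hRc
      rcases Nat.eq_zero_or_pos (A 4 w) with hfree | hen
      · have hres : propose.result ⟨ρ, lay (2 * (I.n + 1) ^ 2) I.input A⟩ =
            ⟨Function.update (Function.update (Function.update (Function.update ρ 16 w) 9 (ρ 9 + 1)) 7
              (ρ 7 + 1)) 8 (ρ 7 + 1),
          lay (2 * (I.n + 1) ^ 2) I.input
              (setArr (setArr A 3 (ρ 8) (A 3 (ρ 8) + 1)) 4 w (ρ 8 + 1))⟩ := by
          simp [propose, nextChoice, rankFor, engage, nextAgent, eval_arr_lay, result_store_lay,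
            result_seq, result_assign_mk, result_ite, result_skip, eval, eval_idx, setArr_ne,
            setArr_same, h1, h2, h3, hTw, hRc, hfree]
        refine Runs.straight I.const_le_bnd hB hbdd ?_ (by decide) (by decide) le_rfl fun hbd => ?_
        · simp [propose, nextChoice, rankFor, engage, nextAgent, Cmd.Bounded, eval_arr_lay,
            result_store_lay, result_seq, result_assign_mk, result_ite, result_skip, eval,
            eval_idx, setArr_ne, setArr_same, h1, h2, h3, hTw, hRc, hfree]
          exact ⟨b5, b1, b2, b3, b4⟩
        · rw [hres] at hbd ⊢
          refine ⟨_, ⟨⟨rfl, ?_, ?_, ?_, hbd, ?_, ?_⟩, ?_, ?_, ?_⟩, ?_⟩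
          all_goals simp [setArr_ne, setArr_same, h1, h2, h3, hcert, hzero]
          · exact hR
          · exact hT
          · exact hinv.accepted hi hp hacc hfree
          · exact remaining_update_lt hcur hex (by omega)
      · obtain ⟨v, hv⟩ := Nat.exists_eq_succ_of_ne_zero hen.ne'
        rw [Nat.succ_eq_add_one] at hv
        obtain ⟨-, -, hvn, -, hvacc, -⟩ := hinv.held w v hv
        have hRv := hR (I.n + w) (by omega) v (by omega)
        rw [GNSPM.rank, if_pos hvacc] at hRv
        by_cases hlt : (I.lst (I.n + w)).idxOf (ρ 8) < (I.lst (I.n + w)).idxOf v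
        · have b6 : v + 1 ≤ I.bnd := I.le_bnd' (by omega)
          have hres : propose.result ⟨ρ, lay (2 * (I.n + 1) ^ 2) I.input A⟩ =
              ⟨Function.update (Function.update (Function.update ρ 16 w) 17 (v + 1)) 8 v,
                lay (2 * (I.n + 1) ^ 2) I.input
                (setArr (setArr A 3 (ρ 8) (A 3 (ρ 8) + 1)) 4 w (ρ 8 + 1))⟩ := by
            simp [propose, nextChoice, rankFor, engage, nextAgent, eval_arr_lay, result_store_lay,
              result_seq, result_assign_mk, result_ite, result_skip, eval, eval_idx, setArr_ne,
              setArr_same, h1, h2, h3, hTw, hRc, hv, hRv, hlt]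
          refine Runs.straight I.const_le_bnd hB hbdd ?_ (by decide) (by decide) le_rfl fun hbd => ?_
          · simp [propose, nextChoice, rankFor, engage, nextAgent, Cmd.Bounded, eval_arr_lay,
              result_store_lay, result_seq, result_assign_mk, result_ite, result_skip, eval,
              eval_idx, setArr_ne, setArr_same, h1, h2, h3, hTw, hRc, hv, hRv, hlt]
            exact ⟨b5, b1, b6, b2, by omega⟩
          · rw [hres] at hbd ⊢
            refine ⟨_, ⟨⟨rfl, ?_, ?_, ?_, hbd, ?_, ?_⟩, ?_, ?_, ?_⟩, ?_⟩
            all_goals simp [setArr_ne, setArr_same, h1, h2, h3, hcert, hzero]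
            · exact hR
            · exact hT
            · exact hinv.replaced hi hp hacc hv hlt
            · exact remaining_update_lt hcur hex le_rfl
        · have hres : propose.result ⟨ρ, lay (2 * (I.n + 1) ^ 2) I.input A⟩ =
              ⟨Function.update ρ 16 w, lay (2 * (I.n + 1) ^ 2) I.input
                (setArr A 3 (ρ 8) (A 3 (ρ 8) + 1))⟩ := by
            simp [propose, nextChoice, rankFor, engage, nextAgent, eval_arr_lay, result_store_lay,
              result_seq, result_assign_mk, result_ite, result_skip, eval, eval_idx, setArr_ne,
              setArr_same, h1, h2, h3, hTw, hRc, hv, hRv, hlt]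
          refine Runs.straight I.const_le_bnd hB hbdd ?_ (by decide) (by decide) le_rfl fun hbd => ?_
          · simp [propose, nextChoice, rankFor, engage, nextAgent, Cmd.Bounded, eval_arr_lay,
              result_store_lay, result_seq, result_assign_mk, result_ite, result_skip, eval,
              eval_idx, setArr_ne, setArr_same, h1, h2, h3, hTw, hRc, hv, hRv, hlt]
            exact ⟨b5, b1⟩
          · rw [hres] at hbd ⊢
            refine ⟨_, ⟨⟨rfl, ?_, ?_, ?_, hbd, ?_, ?_⟩, ?_, ?_, ?_⟩, ?_⟩
            all_goals simp [setArr_ne, setArr_same, h1, h2, h3, hcert, hzero]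
            · exact hR
            · exact hT
            · exact hinv.rejected hp fun _ => ⟨v, hv, not_lt.1 hlt⟩
            · exact remaining_update_lt hcur hex le_rfl
    · rw [GNSPM.rank, if_neg hacc] at hRc
      have hres : propose.result ⟨ρ, lay (2 * (I.n + 1) ^ 2) I.input A⟩ =
          ⟨Function.update ρ 16 w, lay (2 * (I.n + 1) ^ 2) I.input
            (setArr A 3 (ρ 8) (A 3 (ρ 8) + 1))⟩ := by
        simp [propose, nextChoice, rankFor, engage, nextAgent, eval_arr_lay, result_store_lay,
          result_seq, result_assign_mk, result_ite, result_skip, eval, eval_idx, setArr_ne,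
          setArr_same, h1, h2, h3, hTw, hRc]
      refine Runs.straight I.const_le_bnd hB hbdd ?_ (by decide) (by decide) le_rfl fun hbd => ?_
      · simp [propose, nextChoice, rankFor, engage, nextAgent, Cmd.Bounded, eval_arr_lay,
          result_store_lay, result_seq, result_assign_mk, result_ite, result_skip, eval, eval_idx,
          setArr_ne, setArr_same, h1, h2, h3, hTw, hRc]
        exact ⟨b5, b1⟩
      · rw [hres] at hbd ⊢
        refine ⟨_, ⟨⟨rfl, ?_, ?_, ?_, hbd, ?_, ?_⟩, ?_, ?_, ?_⟩, ?_⟩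
        all_goals simp [setArr_ne, setArr_same, h1, h2, h3, hcert, hzero]
        · exact hR
        · exact hT
        · exact hinv.rejected hp fun hc => absurd hc hacc
        · exact remaining_update_lt hcur hex le_rfl
  · have hTw : A 1 (ρ 8 * (I.n + 1) + A 3 (ρ 8)) = 0 := by
      rw [hT', GNSPM.entry, if_neg hex]
    have hres : propose.result ⟨ρ, lay (2 * (I.n + 1) ^ 2) I.input A⟩ =
        ⟨Function.update (Function.update ρ 7 (ρ 7 + 1)) 8 (ρ 7 + 1),
          lay (2 * (I.n + 1) ^ 2) I.input
          (A)⟩ := by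
      simp [propose, nextChoice, rankFor, engage, nextAgent, eval_arr_lay, result_store_lay,
        result_seq, result_assign_mk, result_ite, result_skip, eval, eval_idx, setArr_ne,
        setArr_same, h1, h2, h3, hTw]
    refine Runs.straight I.const_le_bnd hB hbdd ?_ (by decide) (by decide) le_rfl fun hbd => ?_
    · simp [propose, nextChoice, rankFor, engage, nextAgent, Cmd.Bounded, eval_arr_lay,
        result_store_lay, result_seq, result_assign_mk, result_ite, result_skip, eval, eval_idx,
        setArr_ne, setArr_same, h1, h2, h3, hTw]
      exact b4
    · rw [hres] at hbd ⊢
      refine ⟨_, ⟨⟨rfl, ?_, ?_, ?_, hbd, ?_, ?_⟩, ?_, ?_, ?_⟩, ?_⟩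
      all_goals try simp [setArr_ne, setArr_same, h1, h2, h3, hcert, hzero]
      · exact hR
      · exact hT
      · exact hinv.exhausted hi (by omega)
      · exact Nat.add_lt_add_left (by omega) _

theorem deferredAcceptance_runs {I : GNSPM} {B : ℕ} (hB : I.bnd ^ 1000 ≤ B) {A : ℕ → ℕ → ℕ}
    {s : State} (h : Ready I A s) (h0 : s.reg 0 = 0) (hs : ∀ x, 6 < x → s.reg x = 0)
    (hA : ∀ k, 2 ≤ k → A k = fun _ => 0) :
    Runs B deferredAcceptance s (1000 * I.size) fun s' => ∃ A', Ready I A' s' ∧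
      A' 2 = (fun _ => 0) ∧ s'.reg 0 = 0 ∧ ∃ M, I.profile.IsStable M ∧ M.card = s'.reg 9 := by
  -- The measure of a loop is a function of the state alone, so the array `3` is recovered from the
  -- memory.
  have hφ : ∀ {A s}, Ready I A s →
      (fun u => s.mem (2 * (I.n + 1) ^ 2 + 8 * u + 3)) = A 3 := by
    intro A s h
    funext u
    rw [h.mem, lay_array (by omega)]
  refine Runs.loop I.const_le_bnd hB (fun s => ∃ A, DeferredState I A s)
    (fun s => remaining I (fun u => s.mem (2 * (I.n + 1) ^ 2 + 8 * u + 3)) (s.reg 7)) propose.cost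
    (by decide) (by decide) (fun s ⟨A, h⟩ => h.ready.bdd) ?_ ⟨A, h, ?_, hA 2 le_rfl, h0⟩ ?_ ?_
  · rintro s ⟨A, h⟩ hv
    have hi : s.reg 7 < I.n := by
      by_contra hcon
      simp [eval, h.ready.reg1, hcon] at hv
    refine (propose_runs hB h hi).mono le_rfl ?_
    rintro s' ⟨A', h', hlt⟩
    exact ⟨⟨A', h'⟩, by rwa [hφ h.ready, hφ h'.ready]⟩
  · rw [hA 3 (by omega), hA 4 (by omega), hs 7 (by omega), hs 8 (by omega), hs 9 (by omega)]
    exact .init I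
  · have hc : propose.cost + (Expr.lt (.reg 7) (.reg 1)).cost + 1 ≤ 200 := by decide
    have hr : remaining I (fun u => s.mem (2 * (I.n + 1) ^ 2 + 8 * u + 3)) (s.reg 7) ≤ I.size := by
      rw [hφ h, hA 3 (by omega), hs 7 (by omega), I.size_eq, remaining]
      refine le_trans ?_ (I.offset_mono (show I.n ≤ I.n + I.n by omega))
      simp [GNSPM.offset, Finset.sum_add_distrib]
    have := I.le_size
    nlinarith
  · rintro s ⟨A, h⟩ hv
    have hi : s.reg 7 = I.n := by
      by_contra hcon
      have := h.inv.ile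
      simp [eval, h.ready.reg1, show s.reg 7 < I.n by omega] at hv
    have hinv := h.inv
    rw [hi] at hinv
    exact ⟨A, h.ready, h.cert, h.zero, hinv.exists_stable⟩

end WordRAM

/-! ### The kernel -/

namespace Profile

variable {n : ℕ}

theorem listSwapDist_ne_top {l l' : List (Fin n)} (h : listSwapDist l l' ≠ ⊤) :
    l.toFinset = l'.toFinset := by
  by_contra hne
  exact h (if_neg hne)

theorem listSwapDist_le {l l' : List (Fin n)} (h : listSwapDist l l' ≠ ⊤) :
    listSwapDist l l' ≤ (n ^ 2 : ℕ) := by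
  rw [listSwapDist, if_pos (listSwapDist_ne_top h)]
  refine Nat.cast_le.2 ((Finset.card_filter_le _ _).trans ?_)
  rw [Finset.card_product, sq]
  have : l.toFinset.card ≤ n := by simpa using Finset.card_le_univ l.toFinset
  exact Nat.mul_le_mul this this

theorem listSwapDist_U_ne_top {P Q : Profile n} (h : P.swapDist Q ≠ ⊤) (u : Fin n) :
    listSwapDist (P.prefU u) (Q.prefU u) ≠ ⊤ := by
  intro htop
  refine h ?_
  have hle := Finset.single_le_sum (f := fun u => listSwapDist (P.prefU u) (Q.prefU u))
    (fun _ _ => zero_le) (Finset.mem_univ u)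
  simp only [htop, top_le_iff] at hle
  rw [swapDist, hle, top_add]

theorem listSwapDist_W_ne_top {P Q : Profile n} (h : P.swapDist Q ≠ ⊤) (w : Fin n) :
    listSwapDist (P.prefW w) (Q.prefW w) ≠ ⊤ := by
  intro htop
  refine h ?_
  have hle := Finset.single_le_sum (f := fun w => listSwapDist (P.prefW w) (Q.prefW w))
    (fun _ _ => zero_le) (Finset.mem_univ w)
  simp only [htop, top_le_iff] at hle
  rw [swapDist, hle, add_top]

theorem mem_prefU_iff {P Q : Profile n} (h : P.swapDist Q ≠ ⊤) (u w : Fin n) :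
    w ∈ Q.prefU u ↔ w ∈ P.prefU u := by
  rw [← List.mem_toFinset, ← List.mem_toFinset, listSwapDist_ne_top (listSwapDist_U_ne_top h u)]

theorem mem_prefW_iff {P Q : Profile n} (h : P.swapDist Q ≠ ⊤) (u w : Fin n) :
    u ∈ Q.prefW w ↔ u ∈ P.prefW w := by
  rw [← List.mem_toFinset, ← List.mem_toFinset, listSwapDist_ne_top (listSwapDist_W_ne_top h w)]

theorem acceptable_iff {P Q : Profile n} (h : P.swapDist Q ≠ ⊤) (u w : Fin n) :
    Q.Acceptable u w ↔ P.Acceptable u w := by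
  rw [Acceptable, Acceptable, mem_prefU_iff h, mem_prefW_iff h]

/-- Each of the `2n` lists contributes at most `n ^ 2` pairs, unless the distance is infinite. -/
theorem swapDist_le {P Q : Profile n} (h : P.swapDist Q ≠ ⊤) :
    P.swapDist Q ≤ (2 * n ^ 3 : ℕ) := by
  have h₁ : ∑ u, listSwapDist (P.prefU u) (Q.prefU u) ≤ ((n * n ^ 2 : ℕ) : ℕ∞) := by
    refine (Finset.sum_le_card_nsmul _ _ _ fun u _ =>
      listSwapDist_le (listSwapDist_U_ne_top h u)).trans ?_
    simp
  have h₂ : ∑ w, listSwapDist (P.prefW w) (Q.prefW w) ≤ ((n * n ^ 2 : ℕ) : ℕ∞) := by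
    refine (Finset.sum_le_card_nsmul _ _ _ fun w _ =>
      listSwapDist_le (listSwapDist_W_ne_top h w)).trans ?_
    simp
  refine (add_le_add h₁ h₂).trans ?_
  rw [← Nat.cast_add]
  exact Nat.cast_le.2 (by rw [← pow_succ', two_mul])

theorem ne_top_of_le_nat {x : ℕ∞} {d : ℕ} (h : x ≤ d) : x ≠ ⊤ :=
  fun htop => by rw [htop] at h; exact absurd h (by simp)

/-- A perfect nearly stable matching has at most twice as many pairs as a stable matching: no two
agents that are left unmatched by a stable matching are mutually acceptable. -/
theorem le_two_mul_card {P : Profile n} {M M' : Finset (Fin n × Fin n)} {d : ℕ}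
    (hM : P.IsStable M) (hM' : P.GloballyNearlyStable d M') (hp : IsPerfect M') :
    n ≤ 2 * M.card := by
  obtain ⟨Q, hQ, hst⟩ := hM'
  choose f hf using fun u => hp (Sum.inl u)
  have hinj : Function.Injective f := by
    intro u v huv
    by_contra hne
    exact (hst.1.2 _ (hf u) _ (hf v) (fun h => hne (congrArg Prod.fst h))).2 huv
  have hcov : ∀ u, u ∈ M.image Prod.fst ∨ f u ∈ M.image Prod.snd := by
    intro u
    by_contra! hcon
    obtain ⟨h₁, h₂⟩ := hcon
    refine hM.2 u (f u) ⟨(acceptable_iff (ne_top_of_le_nat hQ) _ _).1 (hst.1.1 _ (hf u)),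
      ?_, ?_, ?_⟩
    · exact fun h => h₁ (Finset.mem_image.2 ⟨_, h, rfl⟩)
    · exact fun w h => absurd (Finset.mem_image.2 ⟨_, h, rfl⟩) h₁
    · exact fun w h => absurd (Finset.mem_image.2 ⟨_, h, rfl⟩) h₂
  have huniv : (Finset.univ : Finset (Fin n)) ⊆
      M.image Prod.fst ∪ (M.image Prod.snd).preimage f hinj.injOn := by
    intro u _
    simpa using hcov u
  have hpre : ((M.image Prod.snd).preimage f hinj.injOn).card ≤ M.card :=
    (Finset.card_le_card_of_injOn (t := M.image Prod.snd) f (fun u hu => by simpa using hu)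
      hinj.injOn).trans
      Finset.card_image_le
  have := (Finset.card_le_card huniv).trans (Finset.card_union_le _ _)
  have h₁ : (M.image Prod.fst).card ≤ M.card := Finset.card_image_le
  rw [Finset.card_univ, Fintype.card_fin] at this
  omega

/-- All agents of a stable matching are initially matched. -/
theorem two_mul_card_le {P : Profile n} {M : Finset (Fin n × Fin n)} (hM : P.IsStable M) :
    2 * M.card ≤ P.numMatched := by
  let f : M ⊕ M → {x // P.InitiallyMatched x} := Sum.elim
    (fun p => ⟨Sum.inl p.1.1, M, hM, p.1.2, p.2⟩) (fun p => ⟨Sum.inr p.1.2, M, hM, p.1.1, p.2⟩)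
  have hf : Function.Injective f := by
    rintro (⟨p, hp⟩ | ⟨p, hp⟩) (⟨q, hq⟩ | ⟨q, hq⟩) heq
    · have h : p.1 = q.1 := Sum.inl.inj (congrArg Subtype.val heq)
      by_contra hne
      exact (hM.1.2 p hp q hq (fun h => hne (by subst h; rfl))).1 h
    · exact absurd (congrArg Subtype.val heq) (by simp [f])
    · exact absurd (congrArg Subtype.val heq) (by simp [f])
    · have h : p.2 = q.2 := Sum.inr.inj (congrArg Subtype.val heq)
      by_contra hne
      exact (hM.1.2 p hp q hq (fun h => hne (by subst h; rfl))).2 h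
  have := Nat.card_le_card_of_injective f hf
  rw [Nat.card_eq_fintype_card, Fintype.card_sum, Fintype.card_coe] at this
  rw [numMatched]
  omega

end Profile

/-! ### The two possible outputs of the kernelization -/

namespace GNSPM

/-- An instance with one agent on either side and empty lists. -/
def trivialNo : GNSPM where
  n := 1
  profile := ⟨fun _ => [], fun _ => [], fun _ => List.nodup_nil, fun _ => List.nodup_nil⟩
  d := 0

theorem encode_trivialNo : trivialNo.encode = [1, 0, 0, 0] := rfl

theorem not_isYes_trivialNo : ¬ trivialNo.IsYes := by
  rintro ⟨M, ⟨Q, hQ, hst⟩, hp⟩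
  obtain ⟨w, hw⟩ := hp (Sum.inl (0 : Fin 1))
  have := (Profile.acceptable_iff (Profile.ne_top_of_le_nat hQ) _ _).1 (hst.1.1 _ hw)
  exact List.not_mem_nil this.1

/-- The instance with the distance bound capped at the largest possible swap distance. -/
def cap (I : GNSPM) : GNSPM where
  n := I.n
  profile := I.profile
  d := min I.d (2 * I.n ^ 3)

/-- A finite swap distance never exceeds `2 * n ^ 3`, so the cap loses no solution. It is needed
because `d` counts towards the kernel size. -/
theorem isYes_cap (I : GNSPM) : I.cap.IsYes ↔ I.IsYes := by
  constructor
  · rintro ⟨M, ⟨Q, hQ, hst⟩, hp⟩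
    exact ⟨M, ⟨Q, hQ.trans (Nat.cast_le.2 (min_le_left _ _)), hst⟩, hp⟩
  · rintro ⟨M, ⟨Q, hQ, hst⟩, hp⟩
    refine ⟨M, ⟨Q, ?_, hst⟩, hp⟩
    rcases min_choice I.d (2 * I.n ^ 3) with h | h
    · change _ ≤ ((min I.d (2 * I.n ^ 3) : ℕ) : ℕ∞)
      rw [h]; exact hQ
    · change _ ≤ ((min I.d (2 * I.n ^ 3) : ℕ) : ℕ∞)
      rw [h]; exact Profile.swapDist_le (Profile.ne_top_of_le_nat hQ)

end GNSPM

/-! ### The kernelization program -/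

namespace WordRAM

open WordRAM.Expr

/-- Compute the size of a stable matching. -/
def matchingSize : Cmd := .seq readAll deferredAcceptance

theorem matchingSize_runs {I : GNSPM} {B : ℕ} (hB : I.bnd ^ 1000 ≤ B) :
    Runs B matchingSize (.init I.encode) (1100 * I.size) fun s => ∃ A, Ready I A s ∧
      A 2 = (fun _ => 0) ∧ s.reg 0 = 0 ∧ ∃ M, I.profile.IsStable M ∧ M.card = s.reg 9 :=
  (readAll_runs hB).seq (fun _ ⟨_, h, h0, hs, hA⟩ => deferredAcceptance_runs hB h h0 hs hA)
    (by omega)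

/-- `2 * n ^ 3`, the largest possible swap distance. -/
def maxDist : Expr := .mul (.lit 2) (.mul (.reg 1) (.mul (.reg 1) (.reg 1)))

def writeKernel : Cmd :=
  .ite (.lt (.mul (.lit 2) (.reg 9)) (.reg 1))
    (.seq (.store (.lit 0) (.lit 1)) (.seq (.store (.lit 1) (.lit 0))
      (.seq (.store (.lit 2) (.lit 0)) (.store (.lit 3) (.lit 0)))))
    (.ite (.lt maxDist (.mem (.lit 1))) (.store (.lit 1) maxDist) .skip)

def kernelize : Cmd := .seq matchingSize writeKernel

/-- The output overwrites the input at address `0`. If `n ≤ 2 * M.card`, then `n ≤ nm`, and at most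
the word `d` changes. Otherwise the answer is no and the four words of `trivialNo` are written; its
two agents account for the maximum with `2`. -/
theorem kernelize_runs {I : GNSPM} {B : ℕ} (hB : I.bnd ^ 1000 ≤ B) :
    Runs B kernelize (.init I.encode) (1200 * I.size) fun s => ∃ J : GNSPM,
      s.Outputs J.encode ∧ (J.IsYes ↔ I.IsYes) ∧ 2 * J.n ≤ max (2 * I.nm) 2 ∧
      J.n ≤ I.nm + 1 ∧ J.d ≤ 2 * J.n ^ 3 := by
  have hsz := I.le_size
  refine (matchingSize_runs hB).seq (T₂ := 100 * I.size) ?_ (by omega)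
  rintro ⟨ρ, m⟩ ⟨A, ⟨hm, h1, h2, h3, hbdd, -, -⟩, -, h0, M, hM, hcard⟩
  simp only at hm h1 h2 h3 h0 hcard
  subst hm
  have hnm : 2 * M.card ≤ I.nm := Profile.two_mul_card_le hM
  have hin : ∀ i < I.size, lay (2 * (I.n + 1) ^ 2) I.input A i = I.input i := fun i hi =>
    lay_input (hi.trans_le I.size_le)
  have hdist : 2 * (I.n * (I.n * I.n)) ≤ I.bnd := by
    refine I.le_bnd 3 (by omega) ?_
    have : (2 * I.n) ^ 3 ≤ (I.size + I.d) ^ 3 := Nat.pow_le_pow_left (by omega) 3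
    nlinarith [Nat.zero_le (I.n * (I.n * I.n))]
  have e1 : lay (2 * (I.n + 1) ^ 2) I.input A 1 = I.d := by rw [hin _ (by omega), I.input_one]
  by_cases hlt : 2 * ρ 9 < I.n
  · refine Runs.straight I.const_le_bnd hB hbdd ?_ (by decide) (by decide)
      ((show writeKernel.cost ≤ 100 by decide).trans (by omega)) fun _ => ?_
    · have := I.const_le_bnd
      simp [writeKernel, Cmd.Bounded, eval, h1, hlt]
      omega
    · refine ⟨GNSPM.trivialNo, ?_, iff_of_false GNSPM.not_isYes_trivialNo ?_, ?_, ?_, ?_⟩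
      · rw [GNSPM.encode_trivialNo]
        intro i hi
        simp only [List.length_cons, List.length_nil] at hi
        interval_cases i <;> simp [writeKernel, Cmd.result, eval, h1, h0, hlt]
      · rintro ⟨M', hM', hp⟩
        have := Profile.le_two_mul_card hM hM' hp
        omega
      · exact le_max_right _ _
      · change 1 ≤ _; omega
      · exact Nat.zero_le _
  · refine Runs.straight I.const_le_bnd hB hbdd ?_ (by decide) (by decide)
      ((show writeKernel.cost ≤ 100 by decide).trans (by omega)) fun _ => ?_
    · simp [writeKernel, maxDist, Cmd.Bounded, eval, h1, hlt]
      exact fun _ => hdist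
    · refine ⟨I.cap, ?_, I.isYes_cap, ?_, ?_, ?_⟩
      · intro i hi
        have hi' : i < I.size := hi
        have hmem : ((writeKernel.result ⟨ρ, lay (2 * (I.n + 1) ^ 2) I.input A⟩).mem i) =
            if i = 1 then min I.d (2 * I.n ^ 3) else I.input i := by
          have h3 : 2 * (I.n * (I.n * I.n)) = 2 * I.n ^ 3 := by ring
          by_cases hd : 2 * (I.n * (I.n * I.n)) < I.d
          · simp [writeKernel, maxDist, Cmd.result, eval, h1, hlt, e1, hd, Function.update_apply,
              hin i hi']
            rw [h3, min_eq_right (by omega)]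
          · simp [writeKernel, maxDist, Cmd.result, eval, h1, hlt, e1, hd, hin i hi']
            intro hi1
            rw [hi1, I.input_one, min_eq_left (by omega)]
        have hreg : (writeKernel.result ⟨ρ, lay (2 * (I.n + 1) ^ 2) I.input A⟩).reg 0 = 0 := by
          by_cases hd : 2 * (I.n * (I.n * I.n)) < I.d <;>
            simp [writeKernel, maxDist, Cmd.result, eval, h1, hlt, e1, hd, h0]
        rw [hreg, zero_add, hmem]
        match i, hi with
        | 0, _ => rfl
        | 1, _ => rfl
        | i + 2, hi => exact List.getD_eq_getElem I.cap.encode 0 hi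
      · change 2 * I.n ≤ _
        exact le_max_of_le_left (by omega)
      · change I.n ≤ _; omega
      · exact min_le_right _ _

end WordRAM

/-! ### Certificates for yes-instances -/

theorem List.exists_perm_sorted {α : Type*} [DecidableEq α] (l : List α) (κ : α → ℕ) :
    ∃ l' : List α, l'.Perm l ∧
      ∀ x ∈ l, ∀ y ∈ l, κ x < κ y → l'.idxOf x < l'.idxOf y := by
  refine ⟨l.insertionSort fun x y => κ x ≤ κ y, List.perm_insertionSort _ l, ?_⟩
  intro x hx y hy hlt
  have hs : (l.insertionSort fun x y => κ x ≤ κ y).Pairwise fun x y => κ x ≤ κ y :=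
    haveI : Std.Total fun x y : α => κ x ≤ κ y := ⟨fun x y => le_total _ _⟩
    haveI : IsTrans α fun x y => κ x ≤ κ y := ⟨fun _ _ _ => le_trans⟩
    List.pairwise_insertionSort _ l
  set l' := l.insertionSort fun x y => κ x ≤ κ y with hl'
  have hx' : l'.idxOf x < l'.length :=
    List.idxOf_lt_length_iff.2 ((List.perm_insertionSort _ l).mem_iff.2 hx)
  have hy' : l'.idxOf y < l'.length :=
    List.idxOf_lt_length_iff.2 ((List.perm_insertionSort _ l).mem_iff.2 hy)
  by_contra hcon
  rcases (not_lt.1 hcon).lt_or_eq with h | h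
  · have := List.pairwise_iff_getElem.1 hs _ _ hy' hx' h
    rw [List.getElem_idxOf, List.getElem_idxOf] at this
    omega
  · have : y = x := by
      rw [← List.getElem_idxOf hy', ← List.getElem_idxOf hx']
      simp only [h]
    subst this
    omega

namespace GNSPM

/-- The rank of `x` in the new list of agent `a` for `x < n`, and the partner of `a` for `x = n`,
according to the certificate `Y`. -/
def slot (I : GNSPM) (Y : ℕ → ℕ) (a x : ℕ) : ℕ := Y (a * (I.n + 1) + x)

/-- The new list of `a` orders `x` and `y` differently. -/
def Inverts (I : GNSPM) (Y : ℕ → ℕ) (a x y : ℕ) : Prop :=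
  0 < I.rank a x ∧ I.rank a x < I.rank a y ∧ I.slot Y a y < I.slot Y a x

/-- The partners are not acceptable or do not form a matching, or `a` and `x` block it. -/
def Bad (I : GNSPM) (Y : ℕ → ℕ) (a x : ℕ) : Prop :=
  I.rank a (I.slot Y a I.n) = 0 ∨
  (a < I.n ∧ I.slot Y (I.n + I.slot Y a I.n) I.n ≠ a) ∨
  (a < I.n ∧ 0 < I.rank a x ∧ 0 < I.rank (I.n + x) a ∧ x ≠ I.slot Y a I.n ∧
    I.slot Y a x ≤ I.slot Y a (I.slot Y a I.n) ∧
    I.slot Y (I.n + x) a ≤ I.slot Y (I.n + x) (I.slot Y (I.n + x) I.n))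

open Classical in
/-- The contribution of a triple to the cost of a certificate; defects are prohibitive. -/
noncomputable def weight (I : GNSPM) (Y : ℕ → ℕ) (a x y : ℕ) : ℕ :=
  (if I.Inverts Y a x y then 1 else 0) + (I.d + 1) * (if I.Bad Y a x then 1 else 0)

noncomputable def certCost (I : GNSPM) (Y : ℕ → ℕ) : ℕ :=
  ∑ a ∈ Finset.range (I.n + I.n), ∑ x ∈ Finset.range I.n, ∑ y ∈ Finset.range I.n, I.weight Y a x y

open Classical in
/-- The number of inversions of agent `a`. -/
noncomputable def inversions (I : GNSPM) (Y : ℕ → ℕ) (a : ℕ) : ℕ :=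
  ∑ x ∈ Finset.range I.n, ∑ y ∈ Finset.range I.n, if I.Inverts Y a x y then 1 else 0

/-- A single defect already costs `d + 1`, so a cost of at most `d` excludes defects; without them
only the inversions contribute. -/
theorem certCost_le_iff (I : GNSPM) (Y : ℕ → ℕ) : I.certCost Y ≤ I.d ↔
    (∀ a < I.n + I.n, ∀ x < I.n, ¬ I.Bad Y a x) ∧
      ∑ a ∈ Finset.range (I.n + I.n), I.inversions Y a ≤ I.d := by
  classical
  constructor
  · intro h
    refine ⟨fun a ha x hx hbad => ?_, le_trans ?_ h⟩
    · have h₁ : I.weight Y a x x ≤ I.certCost Y := by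
        refine le_trans ?_ (Finset.single_le_sum (fun _ _ => Nat.zero_le _) (Finset.mem_range.2 ha))
        refine le_trans ?_ (Finset.single_le_sum (fun _ _ => Nat.zero_le _) (Finset.mem_range.2 hx))
        exact Finset.single_le_sum (f := fun y => I.weight Y a x y) (fun _ _ => Nat.zero_le _)
          (Finset.mem_range.2 hx)
      have h₂ : I.d + 1 ≤ I.weight Y a x x := by simp [weight, hbad]
      omega
    · exact Finset.sum_le_sum fun a _ => Finset.sum_le_sum fun x _ => Finset.sum_le_sum fun y _ =>
        Nat.le_add_right _ _
  · rintro ⟨h₁, h₂⟩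
    refine le_trans (le_of_eq ?_) h₂
    refine Finset.sum_congr rfl fun a ha => Finset.sum_congr rfl fun x hx =>
      Finset.sum_congr rfl fun y hy => ?_
    simp [weight, h₁ a (Finset.mem_range.1 ha) x (Finset.mem_range.1 hx)]

theorem rank_eq (I : GNSPM) {a : ℕ} {l : List (Fin I.n)} (hl : I.lst a = l.map Fin.val)
    (x : Fin I.n) : I.rank a x = if x ∈ l then l.idxOf x + 1 else 0 := by
  rw [rank, hl, List.idxOf_map_val]
  simp only [List.mem_map_of_injective Fin.val_injective]

/-- Each reversed pair is counted once, in the order of `l`, so it suffices to compare such pairs.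
The slots of agents outside `l` do not matter, because their rank `0` excludes them from `Inverts`.
-/
theorem listSwapDist_eq (I : GNSPM) (Y : ℕ → ℕ) {a : ℕ} {l l' : List (Fin I.n)}
    (hl : I.lst a = l.map Fin.val) (hset : l.toFinset = l'.toFinset)
    (hord : ∀ x ∈ l, ∀ y ∈ l, l.idxOf x < l.idxOf y →
      (l'.idxOf y < l'.idxOf x ↔ I.slot Y a y < I.slot Y a x)) :
    Profile.listSwapDist l l' = (I.inversions Y a : ℕ∞) := by
  classical
  rw [Profile.listSwapDist, if_pos hset, inversions, Finset.sum_range]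
  simp only [Finset.sum_range]
  rw [← Finset.sum_product', ← Finset.card_filter]
  congr 2
  ext ⟨x, y⟩
  simp only [Finset.mem_filter, Finset.mem_product, List.mem_toFinset, Finset.mem_univ, true_and,
    Inverts, I.rank_eq hl]
  by_cases hx : x ∈ l <;> by_cases hy : y ∈ l
  · simp only [hx, hy, true_and, if_true]
    constructor
    · rintro ⟨h₁, h₂⟩
      exact ⟨by omega, by omega, (hord x hx y hy h₁).1 h₂⟩
    · rintro ⟨-, h₁, h₂⟩
      exact ⟨by omega, (hord x hx y hy (by omega)).2 h₂⟩
  all_goals simp [hx, hy]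

theorem swapDist_eq (I : GNSPM) (Y : ℕ → ℕ) {Q : Profile I.n}
    (hU : ∀ u, Profile.listSwapDist (I.profile.prefU u) (Q.prefU u) = (I.inversions Y u : ℕ∞))
    (hW : ∀ w, Profile.listSwapDist (I.profile.prefW w) (Q.prefW w) =
      (I.inversions Y (I.n + w) : ℕ∞)) :
    I.profile.swapDist Q = ((∑ a ∈ Finset.range (I.n + I.n), I.inversions Y a : ℕ) : ℕ∞) := by
  rw [Profile.swapDist, Finset.sum_range_add, Finset.sum_range, Finset.sum_range]
  push_cast
  simp only [hU, hW]

theorem slot_lt {I : GNSPM} {Y : ℕ → ℕ} (hY : ∀ i < (I.n + I.n) * (I.n + 1), Y i < I.n) {a x : ℕ}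
    (ha : a < I.n + I.n) (hx : x ≤ I.n) : I.slot Y a x < I.n := by
  refine hY _ ?_
  calc a * (I.n + 1) + x < (a + 1) * (I.n + 1) := by linarith
    _ ≤ _ := Nat.mul_le_mul_right _ ha

theorem mem_of_rank_ne_zero (I : GNSPM) {a x : ℕ} (h : I.rank a x ≠ 0) : x ∈ I.lst a := by
  by_contra hcon
  exact h (if_neg hcon)

theorem rank_pos (I : GNSPM) {a x : ℕ} (h : x ∈ I.lst a) : 0 < I.rank a x := by
  rw [rank, if_pos h]; omega

/-- Sort by slot and break ties by the old position. Equal slots then cause no swap, and the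
reversed pairs are exactly those whose slots are strictly reversed, even if slots repeat. -/
theorem exists_resorted (I : GNSPM) (Y : ℕ → ℕ) (a : ℕ) (l : List (Fin I.n)) (hn : l.Nodup) :
    ∃ l' : List (Fin I.n), l'.Perm l ∧
      (∀ x ∈ l, ∀ y ∈ l, I.slot Y a x < I.slot Y a y → l'.idxOf x < l'.idxOf y) ∧
      ∀ x ∈ l, ∀ y ∈ l, l.idxOf x < l.idxOf y →
        (l'.idxOf y < l'.idxOf x ↔ I.slot Y a y < I.slot Y a x) := by
  have hlen : ∀ x : Fin I.n, l.idxOf x < I.n + 1 := fun x =>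
    Nat.lt_succ_of_le (List.idxOf_le_length.trans (by simpa using hn.length_le_card))
  -- The old position is at most `n`, so comparing these numbers is the lexicographic comparison.
  obtain ⟨l', hp, hs⟩ := l.exists_perm_sorted fun x => I.slot Y a x * (I.n + 1) + l.idxOf x
  have h₁ : ∀ x ∈ l, ∀ y ∈ l, I.slot Y a x < I.slot Y a y → l'.idxOf x < l'.idxOf y := by
    intro x hx y hy hlt
    refine hs x hx y hy ?_
    have := hlen x
    nlinarith
  refine ⟨l', hp, h₁, fun x hx y hy hlt => ⟨fun h => ?_, fun h => h₁ y hy x hx h⟩⟩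
  by_contra hcon
  have : l'.idxOf x < l'.idxOf y := by
    refine hs x hx y hy ?_
    have : I.slot Y a x * (I.n + 1) ≤ I.slot Y a y * (I.n + 1) :=
      Nat.mul_le_mul_right _ (not_lt.1 hcon)
    omega
  omega

/-- The slots need not be distinct, and `Bad` compares them non-strictly: a pair that blocks after
resorting has slots no larger than those of the partners, so it is caught however ties are broken.
The partner map on `U` is injective, hence bijective, with the partner column of `W` as inverse. -/
theorem isYes_of_certificate (I : GNSPM) (Y : ℕ → ℕ)
    (hY : ∀ i < (I.n + I.n) * (I.n + 1), Y i < I.n) (hc : I.certCost Y ≤ I.d) : I.IsYes := by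
  obtain ⟨hbad, hinv⟩ := (I.certCost_le_iff Y).1 hc
  choose fU hpU hsU hoU using fun u : Fin I.n =>
    I.exists_resorted Y u (I.profile.prefU u) (I.profile.nodupU u)
  choose fW hpW hsW hoW using fun w : Fin I.n =>
    I.exists_resorted Y (I.n + w) (I.profile.prefW w) (I.profile.nodupW w)
  let Q : Profile I.n := ⟨fU, fW, fun u => (hpU u).nodup_iff.2 (I.profile.nodupU u),
    fun w => (hpW w).nodup_iff.2 (I.profile.nodupW w)⟩
  let p : Fin I.n → Fin I.n := fun u => ⟨I.slot Y u I.n, slot_lt hY (by omega) le_rfl⟩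
  have hpinv : ∀ u, I.slot Y (I.n + (p u : ℕ)) I.n = u := by
    intro u
    by_contra hcon
    -- The first two clauses of `Bad` do not involve `x`; here `u` merely serves as an index below
    -- `n`.
    exact hbad u (by omega) u u.2 (Or.inr (Or.inl ⟨u.2, hcon⟩))
  have hpinj : Function.Injective p := fun u v huv => by
    ext
    rw [← hpinv u, ← hpinv v, huv]
  have hpsurj : Function.Surjective p := Finite.surjective_of_injective hpinj
  have haccU : ∀ u, p u ∈ I.profile.prefU u := fun u =>
    (I.mem_lst_U u (p u)).1 (I.mem_of_rank_ne_zero fun h =>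
      hbad u (by omega) u u.2 (Or.inl h))
  have haccW : ∀ u, u ∈ I.profile.prefW (p u) := fun u => by
    refine (I.mem_lst_W u (p u)).1 (I.mem_of_rank_ne_zero fun h =>
      hbad (I.n + (p u : ℕ)) (by omega) u u.2 (Or.inl ?_))
    rwa [hpinv u]
  have hM : ∀ u w, (u, w) ∈ Finset.univ.image (fun u => (u, p u)) ↔ p u = w := by
    intro u w
    simp
  refine ⟨Finset.univ.image fun u => (u, p u), ⟨Q, ?_, ⟨⟨?_, ?_⟩, ?_⟩⟩, ?_⟩
  · rw [I.swapDist_eq Y]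
    · exact Nat.cast_le.2 hinv
    · exact fun u => I.listSwapDist_eq Y (I.lst_U u) (List.toFinset_eq_of_perm _ _ (hpU u).symm)
        (hoU u)
    · exact fun w => I.listSwapDist_eq Y (I.lst_W w) (List.toFinset_eq_of_perm _ _ (hpW w).symm)
        (hoW w)
  · rintro ⟨u, w⟩ h
    obtain rfl := (hM u w).1 h
    exact ⟨(hpU u).mem_iff.2 (haccU u), (hpW (p u)).mem_iff.2 (haccW u)⟩
  · rintro ⟨u, w⟩ h ⟨u', w'⟩ h' hne
    obtain rfl := (hM u w).1 h
    obtain rfl := (hM u' w').1 h'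
    have : u ≠ u' := by rintro rfl; exact hne rfl
    exact ⟨this, fun h => this (hpinj h)⟩
  · rintro u w ⟨⟨hu, hw⟩, hnot, hbu, hbw⟩
    have hu' : w ∈ I.profile.prefU u := (hpU u).mem_iff.1 hu
    have hw' : u ∈ I.profile.prefW w := (hpW w).mem_iff.1 hw
    have hne : p u ≠ w := fun h => hnot ((hM u w).2 h)
    obtain ⟨v, rfl⟩ := hpsurj w
    refine hbad u (by omega) (p v) (p v).2 (Or.inr (Or.inr ⟨u.2, I.rank_pos ?_, I.rank_pos ?_,
      fun h => hne (Fin.ext h.symm), ?_, ?_⟩))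
    · exact (I.mem_lst_U _ _).2 hu'
    · exact (I.mem_lst_W _ _).2 hw'
    · by_contra hcon
      have h₁ := hsU u (p u) (haccU u) (p v) hu' (not_le.1 hcon)
      have h₂ : (fU u).idxOf (p v) < (fU u).idxOf (p u) := hbu (p u) ((hM _ _).2 rfl)
      omega
    · rw [hpinv v]
      by_contra hcon
      have h₁ := hsW (p v) v (haccW v) u hw' (not_le.1 hcon)
      have h₂ : (fW (p v)).idxOf u < (fW (p v)).idxOf v := hbw v ((hM _ _).2 rfl)
      omega
  · rintro (u | w)
    · exact ⟨p u, (hM _ _).2 rfl⟩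
    · obtain ⟨u, hu⟩ := hpsurj w
      exact ⟨u, (hM _ _).2 hu⟩

/-- The certificate records the ranks in `Q` and the partners in `M`. Now distinct acceptable agents
have distinct slots, so for `x` other than the partner the non-strict comparisons in `Bad` are
strict, and a bad pair would block `M`. -/
theorem exists_certificate (I : GNSPM) (h : I.IsYes) :
    ∃ Y : ℕ → ℕ, (∀ i < (I.n + I.n) * (I.n + 1), Y i < I.n) ∧ I.certCost Y ≤ I.d := by
  obtain ⟨M, ⟨Q, hQ, hst⟩, hp⟩ := h
  have hfin := Profile.ne_top_of_le_nat hQ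
  choose pU hpU using fun u => hp (Sum.inl u)
  choose pW hpW using fun w => hp (Sum.inr w)
  have uniqU : ∀ {u w}, (u, w) ∈ M → w = pU u := fun {u w} h => by
    by_contra hne
    exact (hst.1.2 _ h _ (hpU u) (fun h => hne (congrArg Prod.snd h))).1 rfl
  have uniqW : ∀ {u w}, (u, w) ∈ M → u = pW w := fun {u w} h => by
    by_contra hne
    exact (hst.1.2 _ h _ (hpW w) (fun h => hne (congrArg Prod.fst h))).2 rfl
  -- Introduced only to apply `rank` to the new lists; the distance bound plays no role.
  let J : GNSPM := ⟨I.n, Q, 0⟩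
  let partner : ℕ → ℕ := fun a => if h : a < I.n then pU ⟨a, h⟩
    else if h : a - I.n < I.n then pW ⟨a - I.n, h⟩ else 0
  -- Ranks start at `1`, and unacceptable agents have rank `0`; truncated subtraction yields a digit
  -- below `n` in both cases.
  let Y : ℕ → ℕ := fun i => if i % (I.n + 1) = I.n then partner (i / (I.n + 1)) else
    (J.rank (i / (I.n + 1)) (i % (I.n + 1)) - 1)
  have hdiv : ∀ a x, x ≤ I.n → (a * (I.n + 1) + x) / (I.n + 1) = a := fun a x hx => by
    rw [Nat.add_comm, Nat.add_mul_div_right _ _ (by omega), Nat.div_eq_of_lt (by omega), zero_add]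
  have hmod : ∀ a x, x ≤ I.n → (a * (I.n + 1) + x) % (I.n + 1) = x := fun a x hx => by
    rw [Nat.add_comm, Nat.add_mul_mod_self_right, Nat.mod_eq_of_lt (by omega)]
  have hslot : ∀ a, ∀ x < I.n, I.slot Y a x = J.rank a x - 1 := by
    intro a x hx
    simp only [slot, Y, hdiv a x hx.le, hmod a x hx.le, if_neg hx.ne]
  have hpart : ∀ a, I.slot Y a I.n = partner a := by
    intro a
    simp only [slot, Y, hdiv a I.n le_rfl, hmod a I.n le_rfl, if_true]
  have hpartU : ∀ u : Fin I.n, partner u = pU u := fun u => by simp [partner]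
  have hpartW : ∀ w : Fin I.n, partner (I.n + w) = pW w := fun w => by simp [partner]
  have hslotU : ∀ u : Fin I.n, ∀ x : Fin I.n, x ∈ Q.prefU u →
      I.slot Y u x = (Q.prefU u).idxOf x := fun u x hx => by
    rw [hslot _ _ x.2, J.rank_eq (J.lst_U u) x, if_pos hx]; rfl
  have hslotW : ∀ w : Fin I.n, ∀ x : Fin I.n, x ∈ Q.prefW w →
      I.slot Y (I.n + w) x = (Q.prefW w).idxOf x := fun w x hx => by
    rw [hslot _ _ x.2, show J.rank (I.n + w) x = _ from J.rank_eq (J.lst_W w) x, if_pos hx]; rfl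
  refine ⟨Y, ?_, (I.certCost_le_iff Y).2 ⟨?_, ?_⟩⟩
  · intro i hi
    have hn : 0 < I.n := by
      by_contra h0
      have : I.n = 0 := by omega
      simp [this] at hi
    simp only [Y]
    split_ifs with h
    · simp only [partner]
      split_ifs
      · exact (pU _).2
      · exact (pW _).2
      · exact hn
    · rw [rank]
      split_ifs with hm
      · have h₁ := List.idxOf_lt_length_iff.2 hm
        have h₂ := J.length_lst_le (i / (I.n + 1))
        have h₃ : J.n = I.n := rfl
        omega
      · omega
  · intro a ha x hx
    have hU : ∀ u : Fin I.n, pU u ∈ Q.prefU u := fun u => (hst.1.1 _ (hpU u)).1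
    have hW : ∀ w : Fin I.n, pW w ∈ Q.prefW w := fun w => (hst.1.1 _ (hpW w)).2
    rintro (h | ⟨han, h⟩ | ⟨han, h₁, h₂, h₃, h₄, h₅⟩)
    · rw [hpart] at h
      by_cases han : a < I.n
      · have := I.rank_pos ((I.mem_lst_U ⟨a, han⟩ (pU ⟨a, han⟩)).2
          ((Profile.mem_prefU_iff hfin _ _).1 (hU _)))
        rw [← hpartU ⟨a, han⟩] at this
        exact this.ne' h
      · obtain ⟨w, rfl⟩ := Nat.exists_eq_add_of_le (not_lt.1 han)
        have hw : w < I.n := by omega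
        have := I.rank_pos ((I.mem_lst_W (pW ⟨w, hw⟩) ⟨w, hw⟩).2
          ((Profile.mem_prefW_iff hfin _ _).1 (hW _)))
        rw [← hpartW ⟨w, hw⟩] at this
        exact this.ne' h
    · rw [hpart, hpart, hpartU ⟨a, han⟩, hpartW] at h
      exact h (congrArg Fin.val (uniqW (hpU ⟨a, han⟩))).symm
    · have hxu : (⟨x, hx⟩ : Fin I.n) ∈ Q.prefU ⟨a, han⟩ :=
        (Profile.mem_prefU_iff hfin _ _).2 ((I.mem_lst_U ⟨a, han⟩ ⟨x, hx⟩).1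
          (I.mem_of_rank_ne_zero h₁.ne'))
      have hux : (⟨a, han⟩ : Fin I.n) ∈ Q.prefW ⟨x, hx⟩ :=
        (Profile.mem_prefW_iff hfin _ _).2 ((I.mem_lst_W ⟨a, han⟩ ⟨x, hx⟩).1
          (I.mem_of_rank_ne_zero h₂.ne'))
      rw [hpart, hpartU ⟨a, han⟩] at h₃ h₄
      rw [hpart, hpartW ⟨x, hx⟩, hslotW ⟨x, hx⟩ _ (hW _), hslotW ⟨x, hx⟩ ⟨a, han⟩ hux] at h₅
      rw [hslotU ⟨a, han⟩ _ (hU _), hslotU ⟨a, han⟩ ⟨x, hx⟩ hxu] at h₄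
      have hnot : ((⟨a, han⟩, ⟨x, hx⟩) : Fin I.n × Fin I.n) ∉ M := fun hm =>
        h₃ (congrArg Fin.val (uniqU hm))
      refine hst.2 ⟨a, han⟩ ⟨x, hx⟩ ⟨⟨hxu, hux⟩, hnot, ?_, ?_⟩
      · intro w hw
        obtain rfl := uniqU hw
        refine lt_of_le_of_ne h₄ fun heq => hnot ?_
        rw [(List.idxOf_inj hxu).1 heq]; exact hw
      · intro u hu
        obtain rfl := uniqW hu
        refine lt_of_le_of_ne h₅ fun heq => hnot ?_
        rw [(List.idxOf_inj hux).1 heq]; exact hu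
  · rw [← Nat.cast_le (α := ℕ∞), ← I.swapDist_eq Y (Q := Q)]
    · exact hQ
    · intro u
      have hset := Profile.listSwapDist_ne_top (Profile.listSwapDist_U_ne_top hfin u)
      refine I.listSwapDist_eq Y (I.lst_U u) hset fun x hx y hy _ => ?_
      rw [hslotU u x ((Profile.mem_prefU_iff hfin _ _).2 hx),
        hslotU u y ((Profile.mem_prefU_iff hfin _ _).2 hy)]
    · intro w
      have hset := Profile.listSwapDist_ne_top (Profile.listSwapDist_W_ne_top hfin w)
      refine I.listSwapDist_eq Y (I.lst_W w) hset fun x hx y hy _ => ?_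
      rw [hslotW w x ((Profile.mem_prefW_iff hfin _ _).2 hx),
        hslotW w y ((Profile.mem_prefW_iff hfin _ _).2 hy)]

end GNSPM

/-! ### Counting in base `n` -/

/-- The number with the `L` digits `X 0, …, X (L - 1)` in base `n`. -/
def odometer (n L : ℕ) (X : ℕ → ℕ) : ℕ := ∑ i ∈ Finset.range L, X i * n ^ i

theorem odometer_lt {n L : ℕ} {X : ℕ → ℕ} (hX : ∀ i < L, X i < n) : odometer n L X < n ^ L := by
  induction L with
  | zero => simp [odometer]
  | succ L ih =>
    have h₁ := ih fun i hi => hX i (by omega)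
    have h₂ := hX L (by omega)
    rw [odometer, Finset.sum_range_succ, ← odometer]
    calc odometer n L X + X L * n ^ L < n ^ L + X L * n ^ L := by omega
      _ = (X L + 1) * n ^ L := by ring
      _ ≤ n * n ^ L := Nat.mul_le_mul_right _ h₂
      _ = n ^ (L + 1) := by ring

theorem eq_of_odometer_eq {n L : ℕ} {X Y : ℕ → ℕ} (hX : ∀ i < L, X i < n) (hY : ∀ i < L, Y i < n)
    (h : odometer n L X = odometer n L Y) : ∀ i < L, X i = Y i := by
  induction L with
  | zero => intro i hi; omega
  | succ L ih =>
    have hX' : ∀ i < L, X i < n := fun i hi => hX i (by omega)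
    have hY' : ∀ i < L, Y i < n := fun i hi => hY i (by omega)
    have h₁ := odometer_lt hX'
    have h₂ := odometer_lt hY'
    rw [odometer, odometer, Finset.sum_range_succ, Finset.sum_range_succ, ← odometer, ← odometer,
      add_comm, add_comm (odometer n L Y), mul_add_inj h₁ h₂] at h
    intro i hi
    rcases Nat.lt_succ_iff_lt_or_eq.1 hi with hi | rfl
    · exact ih hX' hY' h.2 i hi
    · exact h.1

theorem odometer_update {n L i : ℕ} (X : ℕ → ℕ) (v : ℕ) (hi : i < L) :
    odometer n L (Function.update X i v) + X i * n ^ i = odometer n L X + v * n ^ i := by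
  have hi' := Finset.mem_range.2 hi
  rw [odometer, odometer, ← Finset.add_sum_erase _ _ hi', ← Finset.add_sum_erase _ _ hi',
    Function.update_self]
  have : ∑ x ∈ (Finset.range L).erase i, Function.update X i v x * n ^ x =
      ∑ x ∈ (Finset.range L).erase i, X x * n ^ x :=
    Finset.sum_congr rfl fun x hx => by rw [Function.update_of_ne (Finset.ne_of_mem_erase hx)]
  rw [this]
  ring

/-! ### Certificates as numerals -/

namespace GNSPM

/-- The number of digits of a certificate. -/
def certLen (I : GNSPM) : ℕ := (I.n + I.n) * (I.n + 1)

/-- The cost looks up only the first `certLen` digits. The partners used as indices in `Bad` stay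
inside the table because digits are below `n`. -/
theorem certCost_congr (I : GNSPM) {X Y : ℕ → ℕ} (hY : ∀ i < I.certLen, Y i < I.n)
    (h : ∀ i < I.certLen, X i = Y i) : I.certCost X = I.certCost Y := by
  have hs : ∀ a < I.n + I.n, ∀ x ≤ I.n, I.slot X a x = I.slot Y a x := fun a ha x hx => by
    refine h _ ?_
    calc a * (I.n + 1) + x < (a + 1) * (I.n + 1) := by linarith
      _ ≤ _ := Nat.mul_le_mul_right _ ha
  refine Finset.sum_congr rfl fun a ha => Finset.sum_congr rfl fun x hx =>
    Finset.sum_congr rfl fun y hy => ?_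
  rw [Finset.mem_range] at ha hx hy
  have hp : I.slot Y a I.n < I.n := slot_lt hY ha le_rfl
  have hq : I.slot Y (I.n + x) I.n < I.n := slot_lt hY (by omega) le_rfl
  have h₁ : I.Inverts X a x y ↔ I.Inverts Y a x y := by
    simp only [Inverts, hs a ha x hx.le, hs a ha y hy.le]
  have h₂ : I.Bad X a x ↔ I.Bad Y a x := by
    simp only [Bad, hs a ha x hx.le, hs a ha I.n le_rfl, hs a ha _ hp.le,
      hs (I.n + x) (by omega) I.n le_rfl, hs (I.n + x) (by omega) _ hq.le,
      hs _ (show I.n + I.slot Y a I.n < I.n + I.n by omega) I.n le_rfl]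
    -- For `a` in `W`, the number `a` is not a valid column, but then the clause of `Bad` that uses
    -- it is void.
    by_cases han : a < I.n
    · simp only [hs (I.n + x) (by omega) a han.le]
    · simp [han]
  rw [weight, weight, propext h₁, propext h₂]

theorem weight_le (I : GNSPM) (Y : ℕ → ℕ) (a x y : ℕ) : I.weight Y a x y ≤ I.d + 2 := by
  rw [weight]
  split_ifs <;> omega

end GNSPM

namespace WordRAM

open WordRAM.Expr

/-! ### Expressions that decide propositions -/

/-- The value of `e` is `1` if `p` holds, and `0` otherwise. -/
def Decides (s : State) (e : Expr) (p : Prop) : Prop :=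
  (p → e.eval s = 1) ∧ (¬ p → e.eval s = 0)

namespace Decides

variable {s : State} {e f : Expr} {p q : Prop}

theorem lt {x y : ℕ} (hx : e.eval s = x) (hy : f.eval s = y) : Decides s (.lt e f) (x < y) := by
  subst hx hy
  exact ⟨fun h => if_pos h, fun h => if_neg h⟩

theorem eq {x y : ℕ} (hx : e.eval s = x) (hy : f.eval s = y) : Decides s (.eq e f) (x = y) := by
  subst hx hy
  exact ⟨fun h => if_pos h, fun h => if_neg h⟩

theorem not (h : Decides s e p) : Decides s (.eq e (.lit 0)) (¬ p) := by
  refine ⟨fun hp => ?_, fun hp => ?_⟩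
  · simp [eval, h.2 hp]
  · simp [eval, h.1 (not_not.1 hp)]

/-- Evaluation has no short circuit, yet `f` need only be correct under `p`: otherwise the product
is `0` whatever `f` reads. -/
theorem and (h : Decides s e p) (h' : p → Decides s f q) : Decides s (.mul e f) (p ∧ q) := by
  refine ⟨fun hp => ?_, fun hp => ?_⟩
  · simp [eval, h.1 hp.1, (h' hp.1).1 hp.2]
  · by_cases h₁ : p
    · simp [eval, (h' h₁).2 fun h₂ => hp ⟨h₁, h₂⟩]
    · simp [eval, h.2 h₁]

theorem or (h : Decides s e p) (h' : Decides s f q) :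
    Decides s (.lt (.lit 0) (.add e f)) (p ∨ q) := by
  refine ⟨fun hp => ?_, fun hp => ?_⟩
  · rcases hp with hp | hp
    · simp [eval, h.1 hp]
    · simp [eval, h'.1 hp]
  · rw [not_or] at hp
    simp [eval, h.2 hp.1, h'.2 hp.2]

theorem eval_eq [Decidable p] (h : Decides s e p) : e.eval s = if p then 1 else 0 := by
  split_ifs with hp
  exacts [h.1 hp, h.2 hp]

end Decides

/-! ### Exhaustive search for a certificate -/

def rankE (a x : Expr) : Expr := arr 0 (idx a x)

def slotE (a x : Expr) : Expr := arr 2 (idx a x)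

/-- The partner of agent `a`. -/
def partnerE (a : Expr) : Expr := slotE a (.reg 1)

def invertsE : Expr :=
  .mul (.lt (.lit 0) (rankE (.reg 10) (.reg 11)))
    (.mul (.lt (rankE (.reg 10) (.reg 11)) (rankE (.reg 10) (.reg 12)))
      (.lt (slotE (.reg 10) (.reg 12)) (slotE (.reg 10) (.reg 11))))

/-- The agent of `W` in register `11`. -/
def agentW : Expr := .add (.reg 1) (.reg 11)

def blocksE : Expr :=
  .mul (.lt (.reg 10) (.reg 1))
    (.mul (.lt (.lit 0) (rankE (.reg 10) (.reg 11)))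
    (.mul (.lt (.lit 0) (rankE agentW (.reg 10)))
    (.mul (.eq (.eq (.reg 11) (partnerE (.reg 10))) (.lit 0))
    (.mul (.lt (slotE (.reg 10) (.reg 11))
        (.add (slotE (.reg 10) (partnerE (.reg 10))) (.lit 1)))
      (.lt (slotE agentW (.reg 10)) (.add (slotE agentW (partnerE agentW)) (.lit 1)))))))

def badE : Expr :=
  .lt (.lit 0) (.add (.eq (rankE (.reg 10) (partnerE (.reg 10))) (.lit 0))
    (.lt (.lit 0) (.add
      (.mul (.lt (.reg 10) (.reg 1))
        (.eq (.eq (partnerE (.add (.reg 1) (partnerE (.reg 10)))) (.reg 10)) (.lit 0)))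
      blocksE)))

def weightE : Expr := .add invertsE (.mul (.add (.mem (.lit 1)) (.lit 1)) badE)

theorem eval_weightE {I : GNSPM} {A : ℕ → ℕ → ℕ} {s : State} (h : Ready I A s)
    (hA : ∀ i < I.certLen, A 2 i < I.n) (ha : s.reg 10 < I.n + I.n) (hx : s.reg 11 < I.n)
    (hy : s.reg 12 < I.n) :
    weightE.eval s = I.weight (A 2) (s.reg 10) (s.reg 11) (s.reg 12) := by
  classical
  have hrank : ∀ {a x : Expr} {a' x' : ℕ}, a.eval s = a' → x.eval s = x' → a' < I.n + I.n →
      x' ≤ I.n → (rankE a x).eval s = I.rank a' x' := by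
    intro a x a' x' ha hx ha' hx'
    rw [rankE, eval_arr (by omega) h.mem h.reg3, eval_idx, h.reg2, ha, hx, h.rank a' ha' x' hx']
  have hslot : ∀ {a x : Expr} {a' x' : ℕ}, a.eval s = a' → x.eval s = x' →
      (slotE a x).eval s = I.slot (A 2) a' x' := by
    intro a x a' x' ha hx
    rw [slotE, eval_arr (by omega) h.mem h.reg3, eval_idx, h.reg2, ha, hx]; rfl
  have hpart : ∀ {a : Expr} {a' : ℕ}, a.eval s = a' →
      (partnerE a).eval s = I.slot (A 2) a' I.n := fun ha => hslot ha h.reg1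
  have r10 : (Expr.reg 10).eval s = s.reg 10 := rfl
  have r11 : (Expr.reg 11).eval s = s.reg 11 := rfl
  have r12 : (Expr.reg 12).eval s = s.reg 12 := rfl
  have r1 : (Expr.reg 1).eval s = I.n := h.reg1
  have l0 : (Expr.lit 0).eval s = 0 := rfl
  have succ : ∀ {e : Expr} {x : ℕ}, e.eval s = x → (Expr.add e (.lit 1)).eval s = x + 1 :=
    fun h => by rw [← h]; rfl
  have hw : agentW.eval s = I.n + s.reg 11 := by rw [← r1]; rfl
  have hpl : I.slot (A 2) (s.reg 10) I.n < I.n := GNSPM.slot_lt hA ha le_rfl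
  have hd : s.mem 1 = I.d := by
    rw [h.mem, lay_input (by nlinarith [I.n.zero_le]), I.input_one]
  have hinv : Decides s invertsE (I.Inverts (A 2) (s.reg 10) (s.reg 11) (s.reg 12)) :=
    (Decides.lt l0 (hrank r10 r11 ha hx.le)).and fun _ =>
      (Decides.lt (hrank r10 r11 ha hx.le) (hrank r10 r12 ha hy.le)).and fun _ =>
        Decides.lt (hslot r10 r12) (hslot r10 r11)
  have hbad : Decides s badE (I.Bad (A 2) (s.reg 10) (s.reg 11)) := by
    refine (Decides.eq (hrank r10 (hpart r10) ha hpl.le) l0).or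
      (((Decides.lt r10 r1).and fun _ => (Decides.eq (hpart ?_) r10).not).or
      ((Decides.lt r10 r1).and fun han => (Decides.lt l0 (hrank r10 r11 ha hx.le)).and fun _ =>
        (Decides.lt l0 (hrank hw r10 (by omega) han.le)).and fun _ =>
        (Decides.eq r11 (hpart r10)).not.and fun _ => ?_))
    · change (Expr.reg 1).eval s + _ = _
      rw [r1, hpart r10]
    -- The machine has no `≤`, so it is tested as `<` with one added on the right.
    · have h₁ := (Decides.lt (hslot r10 r11) (succ (hslot r10 (hpart r10)))).and fun _ =>
        Decides.lt (hslot hw r10) (succ (hslot hw (hpart hw)))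
      simpa only [Nat.lt_succ_iff] using h₁
  change invertsE.eval s + (s.mem 1 + 1) * badE.eval s = _
  rw [hinv.eval_eq, hbad.eval_eq, hd, GNSPM.weight]

/-- Add the weight of the current triple, and go to the next one. -/
def checkBody : Cmd :=
  .seq (.assign 13 (.add (.reg 13) weightE))
    (.ite (.lt (.add (.reg 12) (.lit 1)) (.reg 1)) (.assign 12 (.add (.reg 12) (.lit 1)))
      (.seq (.assign 12 (.lit 0))
        (.ite (.lt (.add (.reg 11) (.lit 1)) (.reg 1)) (.assign 11 (.add (.reg 11) (.lit 1)))
          (.seq (.assign 11 (.lit 0)) (.assign 10 (.add (.reg 10) (.lit 1)))))))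

def checkLoop : Cmd := .loop (.lt (.reg 10) (.add (.reg 1) (.reg 1))) checkBody

/-- The sum of the weights of all triples before `(a, x, y)`. -/
noncomputable def partialCost (I : GNSPM) (Y : ℕ → ℕ) (a x y : ℕ) : ℕ :=
  (∑ a' ∈ Finset.range a, ∑ x' ∈ Finset.range I.n, ∑ y' ∈ Finset.range I.n, I.weight Y a' x' y') +
  (∑ x' ∈ Finset.range x, ∑ y' ∈ Finset.range I.n, I.weight Y a x' y') +
  ∑ y' ∈ Finset.range y, I.weight Y a x y'

/-- The number of triples before `(a, x, y)`. -/
def tripleIndex (n a x y : ℕ) : ℕ := (a * n + x) * n + y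

theorem tripleIndex_lt {n a x y : ℕ} (ha : a < n + n) (hx : x < n) (hy : y < n) :
    tripleIndex n a x y < 2 * n ^ 3 := by
  have h₁ : a * n + x + 1 ≤ (n + n) * n := by nlinarith
  have h₂ : (a * n + x + 1) * n ≤ (n + n) * n * n := Nat.mul_le_mul_right _ h₁
  calc tripleIndex n a x y < (a * n + x + 1) * n := by rw [tripleIndex]; nlinarith
    _ ≤ _ := h₂
    _ = _ := by ring

/-- `accle` keeps the running sum within a word, as every triple weighs at most `d + 2`. `zeros`
fixes the final position, where the partial cost is the full one. -/
structure CheckInv (I : GNSPM) (A : ℕ → ℕ → ℕ) (s : State) : Prop where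
  ready : Ready I A s
  digits : ∀ i < I.certLen, A 2 i < I.n
  ale : s.reg 10 ≤ I.n + I.n
  lts : s.reg 10 < I.n + I.n → s.reg 11 < I.n ∧ s.reg 12 < I.n
  zeros : s.reg 10 = I.n + I.n → s.reg 11 = 0 ∧ s.reg 12 = 0
  acc : s.reg 13 = partialCost I (A 2) (s.reg 10) (s.reg 11) (s.reg 12)
  accle : s.reg 13 ≤ tripleIndex I.n (s.reg 10) (s.reg 11) (s.reg 12) * (I.d + 2)
  zero : s.reg 0 = 0
  zero' : s.reg 15 = 0

theorem checkBody_runs {I : GNSPM} {B : ℕ} (hB : I.bnd ^ 1000 ≤ B) {A : ℕ → ℕ → ℕ} {s : State}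
    (h : CheckInv I A s) (ha : s.reg 10 < I.n + I.n) :
    Runs B checkBody s checkBody.cost fun s' => CheckInv I A s' ∧
      tripleIndex I.n (s'.reg 10) (s'.reg 11) (s'.reg 12) =
        tripleIndex I.n (s.reg 10) (s.reg 11) (s.reg 12) + 1 := by
  have hW := eval_weightE h.ready h.digits ha (h.lts ha).1 (h.lts ha).2
  obtain ⟨ρ, m⟩ := s
  obtain ⟨⟨hm, h1, h2, h3, hbdd, hR, hT⟩, hdig, hale, hlts, -, hacc, haccle, h0, h15⟩ := h
  simp only at hm h1 h2 h3 hale hlts hacc haccle h0 h15 ha hW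
  obtain ⟨hx, hy⟩ := hlts ha
  subst hm
  have hsz := I.le_size
  have hidx := tripleIndex_lt ha hx hy
  have hwle := I.weight_le (A 2) (ρ 10) (ρ 11) (ρ 12)
  set W := I.weight (A 2) (ρ 10) (ρ 11) (ρ 12) with hWdef
  have haccle' : ρ 13 + W ≤ (tripleIndex I.n (ρ 10) (ρ 11) (ρ 12) + 1) * (I.d + 2) := by
    rw [add_mul, one_mul]; omega
  have bacc : ρ 13 + W ≤ I.bnd := by
    refine I.le_bnd 4 (by omega) (haccle'.trans ?_)
    have h₁ : (2 * I.n) ^ 3 ≤ (I.size + I.d) ^ 3 := Nat.pow_le_pow_left (by omega) 3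
    rw [pow_succ]
    refine Nat.mul_le_mul (hidx.trans_le (le_trans ?_ h₁)) (by omega)
    rw [mul_pow]; omega
  have b1 : ρ 12 + 1 ≤ I.bnd := I.le_bnd' (by omega)
  have b2 : ρ 11 + 1 ≤ I.bnd := I.le_bnd' (by omega)
  have b3 : ρ 10 + 1 ≤ I.bnd := I.le_bnd' (by omega)
  by_cases hy' : ρ 12 + 1 < I.n
  · have hres : checkBody.result ⟨ρ, lay (2 * (I.n + 1) ^ 2) I.input A⟩ =
        ⟨Function.update (Function.update ρ 13 (ρ 13 + W)) 12 (ρ 12 + 1),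
          lay (2 * (I.n + 1) ^ 2) I.input A⟩ := by
      simp [checkBody, result_seq, result_assign_mk, result_ite, eval, hW, h1, hy']
    refine Runs.straight I.const_le_bnd hB hbdd ?_ (by decide) (by decide) le_rfl fun hbd => ?_
    · simp [checkBody, Cmd.Bounded, result_seq, result_assign_mk, result_ite, eval, hW, h1, hy']
      exact ⟨bacc, b1⟩
    · rw [hres] at hbd ⊢
      have hti : tripleIndex I.n (ρ 10) (ρ 11) (ρ 12 + 1) =
        tripleIndex I.n (ρ 10) (ρ 11) (ρ 12) + 1 := by simp only [tripleIndex]; ring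
      refine ⟨⟨⟨rfl, ?_, ?_, ?_, hbd, hR, hT⟩, hdig, ?_, ?_, ?_, ?_, ?_, ?_, ?_⟩, ?_⟩
      all_goals simp [h1, h2, h3, h0, h15]
      · omega
      · intro _; omega
      · intro _; omega
      · simp only [partialCost, Finset.sum_range_succ] at hacc ⊢
        rw [hacc]; ring
      · rw [hti]; exact haccle'
      · exact hti
  · have hn : I.n = ρ 12 + 1 := by omega
    by_cases hx' : ρ 11 + 1 < I.n
    · have hres : checkBody.result ⟨ρ, lay (2 * (I.n + 1) ^ 2) I.input A⟩ =
          ⟨Function.update (Function.update (Function.update ρ 13 (ρ 13 + W)) 12 0) 11 (ρ 11 + 1),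
            lay (2 * (I.n + 1) ^ 2) I.input A⟩ := by
        simp [checkBody, result_seq, result_assign_mk, result_ite, eval, hW, h1, hy', hx']
      refine Runs.straight I.const_le_bnd hB hbdd ?_ (by decide) (by decide) le_rfl fun hbd => ?_
      · simp [checkBody, Cmd.Bounded, result_seq, result_assign_mk, result_ite, eval, hW, h1, hy',
          hx']
        exact ⟨bacc, b2⟩
      · rw [hres] at hbd ⊢
        have hti : tripleIndex I.n (ρ 10) (ρ 11 + 1) 0 =
            tripleIndex I.n (ρ 10) (ρ 11) (ρ 12) + 1 := by
          simp only [tripleIndex]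
          calc _ = (ρ 10 * I.n + ρ 11) * I.n + I.n := by ring
            _ = _ := by omega
        refine ⟨⟨⟨rfl, ?_, ?_, ?_, hbd, hR, hT⟩, hdig, ?_, ?_, ?_, ?_, ?_, ?_, ?_⟩, ?_⟩
        all_goals simp [h1, h2, h3, h0, h15]
        · omega
        · intro _; omega
        · omega
        · have hsum : ∑ y' ∈ Finset.range I.n, I.weight (A 2) (ρ 10) (ρ 11) y' =
              (∑ y' ∈ Finset.range (ρ 12), I.weight (A 2) (ρ 10) (ρ 11) y') + W := by
            rw [hWdef, ← Finset.sum_range_succ, ← hn]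
          rw [partialCost] at hacc ⊢
          rw [Finset.sum_range_succ, Finset.sum_range_zero, hsum, hacc]
          ring
        · rw [hti]; exact haccle'
        · exact hti
    · have hn' : I.n = ρ 11 + 1 := by omega
      have hres : checkBody.result ⟨ρ, lay (2 * (I.n + 1) ^ 2) I.input A⟩ =
          ⟨Function.update (Function.update (Function.update (Function.update ρ 13 (ρ 13 + W)) 12 0)
            11 0) 10 (ρ 10 + 1), lay (2 * (I.n + 1) ^ 2) I.input A⟩ := by
        simp [checkBody, result_seq, result_assign_mk, result_ite, eval, hW, h1, hy', hx']
      refine Runs.straight I.const_le_bnd hB hbdd ?_ (by decide) (by decide) le_rfl fun hbd => ?_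
      · simp [checkBody, Cmd.Bounded, result_seq, result_assign_mk, result_ite, eval, hW, h1, hy',
          hx']
        exact ⟨bacc, b3⟩
      · rw [hres] at hbd ⊢
        have hti : tripleIndex I.n (ρ 10 + 1) 0 0 =
            tripleIndex I.n (ρ 10) (ρ 11) (ρ 12) + 1 := by
          simp only [tripleIndex]
          calc _ = (ρ 10 * I.n + I.n) * I.n := by ring
            _ = (ρ 10 * I.n + (ρ 11 + 1)) * I.n := by rw [← hn']
            _ = (ρ 10 * I.n + ρ 11) * I.n + I.n := by ring
            _ = _ := by omega
        refine ⟨⟨⟨rfl, ?_, ?_, ?_, hbd, hR, hT⟩, hdig, ?_, ?_, ?_, ?_, ?_, ?_, ?_⟩, ?_⟩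
        all_goals try simp [h1, h2, h3, h0, h15]
        · omega
        · omega
        · have hsum : ∑ y' ∈ Finset.range I.n, I.weight (A 2) (ρ 10) (ρ 11) y' =
              (∑ y' ∈ Finset.range (ρ 12), I.weight (A 2) (ρ 10) (ρ 11) y') + W := by
            rw [hWdef, ← Finset.sum_range_succ, ← hn]
          have hsum' : ∑ x' ∈ Finset.range I.n, ∑ y' ∈ Finset.range I.n,
              I.weight (A 2) (ρ 10) x' y' = (∑ x' ∈ Finset.range (ρ 11), ∑ y' ∈ Finset.range I.n,
              I.weight (A 2) (ρ 10) x' y') + ∑ y' ∈ Finset.range I.n,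
                I.weight (A 2) (ρ 10) (ρ 11) y' := by
            rw [← Finset.sum_range_succ, ← hn']
          rw [partialCost] at hacc ⊢
          rw [Finset.sum_range_succ, Finset.sum_range_zero, Finset.sum_range_zero, hsum', hsum,
            hacc]
          ring
        · rw [hti]; exact haccle'
        · exact hti

theorem checkLoop_runs {I : GNSPM} {B : ℕ} (hB : I.bnd ^ 1000 ≤ B) {A : ℕ → ℕ → ℕ} {s : State}
    (h : CheckInv I A s) :
    Runs B checkLoop s (1000 * (2 * I.n ^ 3 + 1)) fun s' => Ready I A s' ∧
      s'.reg 13 = I.certCost (A 2) ∧ s'.reg 0 = 0 ∧ s'.reg 15 = 0 := by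
  refine Runs.loop I.const_le_bnd hB (CheckInv I A)
    (fun s => 2 * I.n ^ 3 - tripleIndex I.n (s.reg 10) (s.reg 11) (s.reg 12)) checkBody.cost
    (by decide) (by decide) (fun s h => h.ready.bdd) ?_ h ?_ ?_
  · intro s h hv
    have ha : s.reg 10 < I.n + I.n := by
      by_contra hcon
      simp [eval, h.ready.reg1, hcon] at hv
    refine (checkBody_runs hB h ha).mono le_rfl fun s' h' => ⟨h'.1, ?_⟩
    have := tripleIndex_lt ha (h.lts ha).1 (h.lts ha).2
    have := h'.2
    omega
  · exact Nat.mul_le_mul (by decide) (by omega)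
  · intro s h hv
    have ha : s.reg 10 = I.n + I.n := by
      by_contra hcon
      have := h.ale
      simp [eval, h.ready.reg1, show s.reg 10 < I.n + I.n by omega] at hv
    refine ⟨h.ready, ?_, h.zero, h.zero'⟩
    rw [h.acc, (h.zeros ha).1, (h.zeros ha).2, ha]
    simp [partialCost, GNSPM.certCost]

end WordRAM

/-! ### Enumerating the certificates -/

namespace WordRAM

open WordRAM.Expr

def certLenE : Expr := .mul (.add (.reg 1) (.reg 1)) (.reg 2)

/-- Reset the trailing digits of the certificate that are maximal. -/
def carryLoop : Cmd :=
  .loop (.mul (.lt (.reg 14) certLenE) (.eq (.add (arr 2 (.reg 14)) (.lit 1)) (.reg 1)))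
    (.seq (.store (addr 2 (.reg 14)) (.lit 0)) (.assign 14 (.add (.reg 14) (.lit 1))))

/-- Go to the next certificate. -/
def advance : Cmd :=
  .seq (.assign 14 (.lit 0)) (.seq carryLoop
    (.ite (.lt (.reg 14) certLenE)
      (.store (addr 2 (.reg 14)) (.add (arr 2 (.reg 14)) (.lit 1))) (.assign 15 (.lit 1))))

def resetTriple : Cmd :=
  .seq (.assign 10 (.lit 0)) (.seq (.assign 11 (.lit 0)) (.seq (.assign 12 (.lit 0))
    (.assign 13 (.lit 0))))

def searchBody : Cmd :=
  .seq resetTriple (.seq checkLoop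
    (.ite (.lt (.reg 13) (.add (.mem (.lit 1)) (.lit 1))) (.assign 0 (.lit 1)) advance))

/-- Register `0` is set when a certificate is found, register `15` when there are no more. -/
def search : Cmd := .loop (.eq (.add (.reg 0) (.reg 15)) (.lit 0)) searchBody

/-- The target value is `v + 1`, and a carry pending at position `i` is worth `n ^ i`. Resetting a
digit `n - 1` there trades it for a carry worth `n ^ (i + 1)`, which preserves `value`. -/
structure CarryInv (I : GNSPM) (v : ℕ) (A : ℕ → ℕ → ℕ) (s : State) : Prop where
  ready : Ready I A s
  digits : ∀ i < I.certLen, A 2 i < I.n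
  ile : s.reg 14 ≤ I.certLen
  value : odometer I.n I.certLen (A 2) + I.n ^ s.reg 14 = v + 1
  zero : s.reg 0 = 0
  zero' : s.reg 15 = 0

theorem certLen_le_bnd (I : GNSPM) : I.certLen + 1 ≤ I.bnd := by
  have := I.le_size
  refine I.le_bnd 3 (by omega) ?_
  have h₁ : (2 * I.n + 2) ^ 3 ≤ (I.size + I.d) ^ 3 := Nat.pow_le_pow_left (by omega) 3
  refine le_trans ?_ h₁
  rw [GNSPM.certLen]
  ring_nf
  nlinarith [Nat.zero_le (I.n ^ 3)]

theorem eval_certLenE {I : GNSPM} {A : ℕ → ℕ → ℕ} {s : State} (h : Ready I A s) :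
    certLenE.eval s = I.certLen := by
  change (s.reg 1 + s.reg 1) * s.reg 2 = _
  rw [h.reg1, h.reg2]; rfl

theorem carryLoop_runs {I : GNSPM} {B : ℕ} (hB : I.bnd ^ 1000 ≤ B) {A : ℕ → ℕ → ℕ} {s : State}
    {v : ℕ} (h : CarryInv I v A s) :
    Runs B carryLoop s (1000 * (I.certLen + 1)) fun s' => ∃ A', CarryInv I v A' s' ∧
      (s'.reg 14 < I.certLen → A' 2 (s'.reg 14) + 1 < I.n) := by
  have hcond : ∀ {A s}, CarryInv I v A s →
      Decides s (.mul (.lt (.reg 14) certLenE) (.eq (.add (arr 2 (.reg 14)) (.lit 1)) (.reg 1)))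
        (s.reg 14 < I.certLen ∧ A 2 (s.reg 14) + 1 = I.n) := fun {A s} h =>
    (Decides.lt rfl (eval_certLenE h.ready)).and fun _ => Decides.eq
      (by change (arr 2 _).eval s + 1 = _
          rw [eval_arr (by omega) h.ready.mem h.ready.reg3]; rfl) h.ready.reg1
  refine Runs.loop I.const_le_bnd hB (fun s => ∃ A, CarryInv I v A s)
    (fun s => I.certLen - s.reg 14) 100
    (by decide) (by decide) (fun s ⟨A, h⟩ => h.ready.bdd) ?_ ⟨A, h⟩ ?_ ?_
  · rintro s ⟨A, h⟩ hv
    have hc : s.reg 14 < I.certLen ∧ A 2 (s.reg 14) + 1 = I.n := by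
      by_contra hcon
      exact hv ((hcond h).2 hcon)
    obtain ⟨ρ, m⟩ := s
    obtain ⟨⟨hm, h1, h2, h3, hbdd, hR, hT⟩, hdig, hile, hval, h0, h15⟩ := h
    simp only at hm h1 h2 h3 hile hval h0 h15 hc
    obtain ⟨hlt, hmax⟩ := hc
    subst hm
    refine Runs.straight I.const_le_bnd hB hbdd ?_ (by decide) (by decide) (by decide) fun hbd => ?_
    · simp [Cmd.Bounded, result_store_lay, h3, eval]
      have := certLen_le_bnd I
      omega
    · rw [result_seq, result_store_lay (by omega) h3, result_assign_mk] at hbd ⊢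
      refine ⟨⟨_, ⟨rfl, ?_, ?_, ?_, hbd, ?_, ?_⟩, ?_, ?_, ?_, ?_, ?_⟩, ?_⟩
      all_goals simp [setArr_ne, setArr_same, h1, h2, h3, h0, h15, eval]
      · exact hR
      · exact hT
      · intro i hi
        rw [Function.update_apply]
        split_ifs
        · omega
        · exact hdig i hi
      · exact hlt
      · have := odometer_update (n := I.n) (A 2) 0 hlt
        have e : I.n ^ (ρ 14 + 1) = A 2 (ρ 14) * I.n ^ ρ 14 + I.n ^ ρ 14 := by
          rw [pow_succ']
          nth_rw 1 [← hmax]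
          ring
        omega
      · omega
  · exact Nat.mul_le_mul (by decide) (by omega)
  · rintro s ⟨A, h⟩ hv
    refine ⟨A, h, fun hlt => ?_⟩
    have hne : A 2 (s.reg 14) + 1 ≠ I.n := by
      intro heq
      have := (hcond h).1 ⟨hlt, heq⟩
      omega
    have := h.digits _ hlt
    omega

/-- All certificates with value less than `v` are too expensive. -/
def Refuted (I : GNSPM) (v : ℕ) : Prop :=
  ∀ Y : ℕ → ℕ, (∀ i < I.certLen, Y i < I.n) → odometer I.n I.certLen Y < v → I.d < I.certCost Y

structure Searching (I : GNSPM) (A : ℕ → ℕ → ℕ) (v : ℕ) (s : State) : Prop where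
  ready : Ready I A s
  digits : ∀ i < I.certLen, A 2 i < I.n
  value : odometer I.n I.certLen (A 2) = v
  refuted : Refuted I v
  zero : s.reg 0 = 0
  zero' : s.reg 15 = 0

/-- The search is over, and register `0` holds the answer. -/
structure Searched (I : GNSPM) (s : State) : Prop where
  bdd : s.Bdd I.bnd
  answer : s.Answers I.IsYes
  halted : s.reg 0 + s.reg 15 ≠ 0

/-- If the carry runs past the last digit, then `v + 1 ≥ n ^ certLen`. Every certificate is then
refuted, so the answer is no. -/
theorem advance_runs {I : GNSPM} {B : ℕ} (hB : I.bnd ^ 1000 ≤ B) {A : ℕ → ℕ → ℕ} {s : State}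
    {v : ℕ} (h : Ready I A s) (hdig : ∀ i < I.certLen, A 2 i < I.n)
    (hval : odometer I.n I.certLen (A 2) = v) (hv : Refuted I (v + 1)) (h0 : s.reg 0 = 0)
    (h15 : s.reg 15 = 0) :
    Runs B advance s (1000 * (I.certLen + 1) + 200) fun s' =>
      (∃ A', Searching I A' (v + 1) s') ∨ Searched I s' := by
  refine Runs.seq (T₁ := 10) (T₂ := 1000 * (I.certLen + 1) + 100)
    (Q₁ := fun s' => CarryInv I v A s') ?_ ?_ (by omega)
  · refine Runs.straight I.const_le_bnd hB h.bdd ?_ (by decide) (by decide) (by decide)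
      fun hbd => ?_
    · simp [Cmd.Bounded, eval]
    · refine ⟨⟨h.mem, ?_, ?_, ?_, hbd, h.rank, h.entry⟩, hdig, ?_, ?_, ?_, ?_⟩
      all_goals simp [Cmd.result, h.reg1, h.reg2, h.reg3, h0, h15, eval, hval]
  · intro s₁ h₁
    refine (carryLoop_runs hB h₁).seq (T₂ := 100) ?_ le_rfl
    rintro ⟨ρ, m⟩ ⟨A', h', hlast⟩
    have hL := eval_certLenE h'.ready
    obtain ⟨⟨hm, h1, h2, h3, hbdd, hR, hT⟩, hdig', hile, hval', h0', h15'⟩ := h'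
    simp only at hm h1 h2 h3 hile hval' h0' h15' hlast hL
    subst hm
    by_cases hlt : ρ 14 < I.certLen
    · have hlast' := hlast hlt
      have hres : (Cmd.ite (.lt (.reg 14) certLenE)
          (.store (addr 2 (.reg 14)) (.add (arr 2 (.reg 14)) (.lit 1)))
          (.assign 15 (.lit 1))).result ⟨ρ, lay (2 * (I.n + 1) ^ 2) I.input A'⟩ =
          ⟨ρ, lay (2 * (I.n + 1) ^ 2) I.input (setArr A' 2 (ρ 14) (A' 2 (ρ 14) + 1))⟩ := by
        simp [result_ite, result_store_lay, h3, eval, eval_arr_lay, hL, hlt]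
      refine Runs.straight I.const_le_bnd hB hbdd ?_ (by decide) (by decide) (by decide)
        fun hbd => ?_
      · have := I.le_size
        simp [Cmd.Bounded, eval, eval_arr_lay, hL, hlt, h3]
        exact I.le_bnd' (by omega)
      · rw [hres] at hbd ⊢
        refine Or.inl ⟨_, ⟨rfl, ?_, ?_, ?_, hbd, ?_, ?_⟩, ?_, ?_, hv, ?_, ?_⟩
        all_goals simp [setArr_ne, setArr_same, h1, h2, h3, h0', h15', eval]
        · exact hR
        · exact hT
        · intro i hi
          rw [Function.update_apply]
          split_ifs
          · omega
          · exact hdig' i hi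
        · have := odometer_update (n := I.n) (A' 2) (A' 2 (ρ 14) + 1) hlt
          rw [add_mul, one_mul] at this
          omega
    · have hres : (Cmd.ite (.lt (.reg 14) certLenE)
          (.store (addr 2 (.reg 14)) (.add (arr 2 (.reg 14)) (.lit 1)))
          (.assign 15 (.lit 1))).result ⟨ρ, lay (2 * (I.n + 1) ^ 2) I.input A'⟩ =
          ⟨Function.update ρ 15 1, lay (2 * (I.n + 1) ^ 2) I.input A'⟩ := by
        simp [result_ite, result_assign_mk, eval, hL, hlt]
      have hend : ρ 14 = I.certLen := by omega
      have hno : ¬ I.IsYes := by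
        intro hyes
        obtain ⟨Y, hY, hc⟩ := I.exists_certificate hyes
        have := odometer_lt hY
        have := hv Y hY (by
          rw [hend] at hval'
          exact (odometer_lt (L := I.certLen) hY).trans_le (by omega))
        omega
      refine Runs.straight I.const_le_bnd hB hbdd ?_ (by decide) (by decide) (by decide)
        fun hbd => ?_
      · have := I.const_le_bnd
        simp [Cmd.Bounded, eval, hL, hlt]
        omega
      · rw [hres] at hbd ⊢
        exact Or.inr ⟨hbd, ⟨fun hy => absurd hy hno, fun _ => by simp [h0']⟩, by simp [h0']⟩

/-- A bound on the time for the examination of one certificate. -/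
def roundTime (n : ℕ) : ℕ := 10000 * (n + 1) ^ 3

theorem searchBody_runs {I : GNSPM} {B : ℕ} (hB : I.bnd ^ 1000 ≤ B) {A : ℕ → ℕ → ℕ} {s : State}
    {v : ℕ} (h : Searching I A v s) :
    Runs B searchBody s (roundTime I.n) fun s' =>
      (∃ A', Searching I A' (v + 1) s') ∨ Searched I s' := by
  refine Runs.seq (T₁ := 20) (T₂ := 1000 * (2 * I.n ^ 3 + 1) + 1000 * (I.certLen + 1) + 300)
    (Q₁ := CheckInv I A) ?_ ?_ ?_
  · refine Runs.straight I.const_le_bnd hB h.ready.bdd ?_ (by decide) (by decide) (by decide)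
      fun hbd => ?_
    · simp [resetTriple, Cmd.Bounded, eval]
    · refine ⟨⟨h.ready.mem, ?_, ?_, ?_, hbd, h.ready.rank, h.ready.entry⟩, h.digits,
        ?_, ?_, ?_, ?_, ?_, ?_, ?_⟩
      all_goals simp [resetTriple, Cmd.result, h.ready.reg1, h.ready.reg2, h.ready.reg3, h.zero,
        h.zero', eval, partialCost, tripleIndex]
  · intro s₁ h₁
    refine (checkLoop_runs hB h₁).seq (T₂ := 1000 * (I.certLen + 1) + 300) ?_ (by omega)
    rintro s₂ ⟨hr, hc, h0, h15⟩
    have hd : s₂.mem 1 = I.d := by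
      rw [hr.mem, lay_input (by nlinarith [I.n.zero_le]), I.input_one]
    have hcond : Decides s₂ (.lt (.reg 13) (.add (.mem (.lit 1)) (.lit 1)))
        (I.certCost (A 2) < I.d + 1) :=
      Decides.lt hc (by change s₂.mem 1 + 1 = _; rw [hd])
    refine Runs.ite I.const_le_bnd hB hr.bdd (by decide) (by decide)
      (T' := 1000 * (I.certLen + 1) + 200) ?_ ?_
      (by have : (Expr.lt (.reg 13) (.add (.mem (.lit 1)) (.lit 1))).cost = 6 := rfl
          omega)
    · intro hne
      have hle : I.certCost (A 2) < I.d + 1 := by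
        by_contra hcon
        exact hne (hcond.2 hcon)
      have hyes := I.isYes_of_certificate (A 2) h.digits (by omega)
      refine Runs.straight I.const_le_bnd hB hr.bdd ?_ (by decide) (by decide)
        ((show _ ≤ 200 by decide).trans (by omega)) fun hbd => Or.inr ⟨hbd, ⟨?_, ?_⟩, ?_⟩
      · have := I.const_le_bnd
        simp [Cmd.Bounded, eval]
        omega
      · intro _; simp [Cmd.result, eval]
      · exact fun hno => absurd hyes hno
      · simp [Cmd.result, eval]
    · intro heq
      have hgt : I.d < I.certCost (A 2) := by
        by_contra hcon
        have := hcond.1 (by omega)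
        omega
      refine advance_runs hB hr h.digits h.value ?_ h0 h15
      intro Y hY hlt
      rcases Nat.lt_succ_iff_lt_or_eq.1 hlt with hlt | heq
      · exact h.refuted Y hY hlt
      -- A certificate with the value `v` has the same digits as the current one, hence the same
      -- cost.
      · rwa [I.certCost_congr h.digits (eq_of_odometer_eq hY h.digits (heq.trans h.value.symm))]
  · rw [roundTime, GNSPM.certLen]
    ring_nf
    nlinarith [Nat.zero_le (I.n ^ 3)]

/-- Each round that continues eliminates one of the `n ^ certLen` values, and the measure drops to
`0` once a flag is set. For `n = 0` there is one certificate, the empty one. -/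
theorem search_runs {I : GNSPM} {B : ℕ} (hB : I.bnd ^ 1000 ≤ B) {A : ℕ → ℕ → ℕ} {s : State}
    (h : Ready I A s) (hA : A 2 = fun _ => 0) (h0 : s.reg 0 = 0) (h15 : s.reg 15 = 0) :
    Runs B search s ((roundTime I.n + 10) * (I.n ^ I.certLen + 1)) fun s' =>
      s'.Answers I.IsYes := by
  have hφ : ∀ {A s}, Ready I A s →
      (fun u => s.mem (2 * (I.n + 1) ^ 2 + 8 * u + 2)) = A 2 := by
    intro A s h
    funext u
    rw [h.mem, lay_array (by omega)]
  refine Runs.loop I.const_le_bnd hB (fun s => (∃ A v, Searching I A v s) ∨ Searched I s)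
    (fun s => if s.reg 0 + s.reg 15 = 0 then I.n ^ I.certLen - odometer I.n I.certLen
      (fun u => s.mem (2 * (I.n + 1) ^ 2 + 8 * u + 2)) else 0) (roundTime I.n)
    (by decide) (by decide) ?_ ?_ (Or.inl ⟨A, 0, ?_⟩) ?_ ?_
  · rintro s (⟨A, v, h⟩ | h)
    exacts [h.ready.bdd, h.bdd]
  · rintro s (⟨A, v, h⟩ | h) hv
    · refine (searchBody_runs hB h).mono le_rfl ?_
      have hlt := odometer_lt h.digits
      rintro s' (⟨A', h'⟩ | h')
      · refine ⟨Or.inl ⟨A', _, h'⟩, ?_⟩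
        have e := h.value
        have e' := h'.value
        simp only [h.zero, h.zero', h'.zero, h'.zero', add_zero, if_true, hφ h.ready, hφ h'.ready]
        omega
      · refine ⟨Or.inr h', ?_⟩
        simp only [h.zero, h.zero', add_zero, if_true, hφ h.ready, if_neg h'.halted]
        omega
    · have : s.reg 0 + s.reg 15 = 0 := by
        by_contra hcon
        simp [eval] at hv
        omega
      exact absurd this h.halted
  · have hodo : odometer I.n I.certLen (A 2) = 0 := by simp [odometer, hA]
    refine ⟨h, fun i hi => ?_, hodo, fun _ _ hlt => absurd hlt (by omega), h0, h15⟩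
    rw [hA]
    by_contra hcon
    have : I.n = 0 := by simp at hcon; omega
    simp [GNSPM.certLen, this] at hi
  · refine Nat.mul_le_mul ?_ ?_
    · have : (Expr.eq (.add (.reg 0) (.reg 15)) (.lit 0)).cost = 5 := rfl
      omega
    · split_ifs <;> omega
  · rintro s (⟨A, v, h⟩ | h) hv
    · simp [eval, h.zero, h.zero'] at hv
    · exact h.answer

/-! ### The decision algorithm and its running time -/

def solve : Cmd :=
  .seq matchingSize (.ite (.lt (.mul (.lit 2) (.reg 9)) (.reg 1)) .skip
    -- The postcondition of `matchingSize` says nothing about register `15`, so the flag is cleared.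
    (.seq (.assign 15 (.lit 0)) search))

/-- The running time of `solve`: the search takes place only if `n ≤ nm`. -/
theorem solve_runs {I : GNSPM} {B : ℕ} (hB : I.bnd ^ 1000 ≤ B) :
    Runs B solve (.init I.encode) (1200 * I.size + if I.n ≤ I.nm then
      (roundTime I.n + 10) * (I.n ^ I.certLen + 1) else 0) fun s => s.Answers I.IsYes := by
  have hsz := I.le_size
  refine (matchingSize_runs hB).seq (T₂ := 100 * I.size + if I.n ≤ I.nm then
      (roundTime I.n + 10) * (I.n ^ I.certLen + 1) else 0) ?_ (by omega)
  rintro s ⟨A, h, hA, h0, M, hM, hcard⟩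
  have hnm : 2 * M.card ≤ I.nm := Profile.two_mul_card_le hM
  have hcond : Decides s (.lt (.mul (.lit 2) (.reg 9)) (.reg 1)) (2 * s.reg 9 < I.n) :=
    Decides.lt rfl h.reg1
  refine Runs.ite I.const_le_bnd hB h.bdd (by decide) (by decide) (T' := 50 * I.size +
    if I.n ≤ I.nm then (roundTime I.n + 10) * (I.n ^ I.certLen + 1) else 0) ?_ ?_
    (by have : (Expr.lt (.mul (.lit 2) (.reg 9)) (.reg 1)).cost = 5 := rfl
        omega)
  · intro hne
    have hlt : 2 * s.reg 9 < I.n := by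
      by_contra hcon
      exact hne (hcond.2 hcon)
    refine Runs.straight I.const_le_bnd hB h.bdd trivial (by decide) (by decide)
      ((show _ ≤ 50 by decide).trans (by omega)) fun _ => ⟨fun ⟨M', hM', hp⟩ => ?_, fun _ => h0⟩
    have := Profile.le_two_mul_card hM hM' hp
    omega
  · intro heq
    have hle : I.n ≤ 2 * s.reg 9 := by
      by_contra hcon
      have := hcond.1 (by omega)
      omega
    rw [if_pos (by omega)]
    refine Runs.seq (T₁ := 50) (T₂ := (roundTime I.n + 10) * (I.n ^ I.certLen + 1))
      (Q₁ := fun s' => Ready I A s' ∧ s'.reg 0 = 0 ∧ s'.reg 15 = 0) ?_ ?_ (by omega)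
    · refine Runs.straight I.const_le_bnd hB h.bdd ?_ (by decide) (by decide) (by decide)
        fun hbd => ⟨⟨h.mem, ?_, ?_, ?_, hbd, h.rank, h.entry⟩, ?_, ?_⟩
      · simp [Cmd.Bounded, eval]
      all_goals simp [Cmd.result, h.reg1, h.reg2, h.reg3, h0, eval]
    · rintro s' ⟨h', h0', h15'⟩
      exact search_runs hB h' hA h0' h15'

end WordRAM

/-! ### Running times -/

/-- A bound on the time for the exhaustive search on `n` agents per side. -/
def searchTime (n : ℕ) : ℕ :=
  (WordRAM.roundTime n + 10) * (n ^ ((n + n) * (n + 1)) + 1)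

theorem searchTime_mono {m n : ℕ} (h : m ≤ n) : searchTime m ≤ searchTime n := by
  unfold searchTime WordRAM.roundTime
  have h₁ : (m + 1) ^ 3 ≤ (n + 1) ^ 3 := Nat.pow_le_pow_left (by omega) 3
  have h₂ : m ^ ((m + m) * (m + 1)) ≤ n ^ ((n + n) * (n + 1)) := by
    rcases Nat.eq_zero_or_pos m with rfl | hm
    · rcases Nat.eq_zero_or_pos n with rfl | hn
      · exact le_rfl
      · simpa using Nat.one_le_pow _ _ hn
    · exact (Nat.pow_le_pow_left h _).trans (Nat.pow_le_pow_right (by omega)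
        (Nat.mul_le_mul (by omega) (by omega)))
  exact Nat.mul_le_mul (by omega) (by omega)

/-- The polynomial factor is moved into the exponent: `3 + 2m(m + 1) ≤ 4m²`. -/
theorem searchTime_le {m : ℕ} (hm : 3 ≤ m) : searchTime m ≤ 200000 * m ^ (4 * m ^ 2) := by
  have h₁ : (m + 1) ^ 3 ≤ 8 * m ^ 3 :=
    (Nat.pow_le_pow_left (show m + 1 ≤ 2 * m by omega) 3).trans (le_of_eq (by ring))
  have h₂ : 1 ≤ m ^ 3 := Nat.one_le_pow _ _ (by omega)
  have h₃ : 1 ≤ m ^ ((m + m) * (m + 1)) := Nat.one_le_pow _ _ (by omega)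
  have h₄ : m ^ 3 * m ^ ((m + m) * (m + 1)) ≤ m ^ (4 * m ^ 2) := by
    rw [← pow_add]
    exact Nat.pow_le_pow_right (by omega) (by nlinarith)
  calc searchTime m ≤ (100000 * m ^ 3) * (2 * m ^ ((m + m) * (m + 1))) :=
        Nat.mul_le_mul (by unfold WordRAM.roundTime; omega) (by omega)
    _ = 200000 * (m ^ 3 * m ^ ((m + m) * (m + 1))) := by ring
    _ ≤ _ := Nat.mul_le_mul_left _ h₄

/-- For `m = 0` the exponent is `0`, and `0 ^ 0 = 1` for real powers agrees with the convention of
the theorem. -/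
theorem one_le_rpow_sq_mul_log (m : ℕ) : 1 ≤ (m : ℝ) ^ ((m : ℝ) ^ 2 * Real.log m) := by
  rcases Nat.eq_zero_or_pos m with rfl | hm
  · simp
  · have h1 : (1 : ℝ) ≤ m := by exact_mod_cast hm
    exact Real.one_le_rpow h1 (mul_nonneg (sq_nonneg _) (Real.log_nonneg h1))

/-- The search takes `O(m^(4m²))` time, and `log m ≥ 4` from `m = 81 = 3⁴ > e⁴` on. Smaller `m` are
absorbed by the constant, since the power on the right is at least `1`. -/
theorem exists_searchTime_le_rpow : ∃ K : ℝ, 0 ≤ K ∧ ∀ m : ℕ,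
    (searchTime m : ℝ) ≤ K * (m : ℝ) ^ ((m : ℝ) ^ 2 * Real.log m) := by
  refine ⟨searchTime 81 + 200000, by positivity, fun m => ?_⟩
  have hE := one_le_rpow_sq_mul_log m
  have h81 : (0 : ℝ) ≤ searchTime 81 := Nat.cast_nonneg _
  rcases lt_or_ge m 81 with hm | hm
  · have : (searchTime m : ℝ) ≤ searchTime 81 := Nat.cast_le.2 (searchTime_mono hm.le)
    nlinarith
  · have h1 : (1 : ℝ) ≤ m := by exact_mod_cast (show 1 ≤ m by omega)
    have hlog : 4 ≤ Real.log m := by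
      rw [Real.le_log_iff_exp_le (by linarith)]
      calc Real.exp 4 = Real.exp 1 ^ 4 := by rw [← Real.exp_nat_mul]; norm_num
        _ ≤ 3 ^ 4 := pow_le_pow_left₀ (Real.exp_pos _).le
            (Real.exp_one_lt_d9.le.trans (by norm_num)) 4
        _ = ((81 : ℕ) : ℝ) := by norm_num
        _ ≤ m := Nat.cast_le.2 hm
    have hpow : ((m ^ (4 * m ^ 2) : ℕ) : ℝ) ≤ (m : ℝ) ^ ((m : ℝ) ^ 2 * Real.log m) := by
      rw [Nat.cast_pow, ← Real.rpow_natCast]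
      refine Real.rpow_le_rpow_of_exponent_le h1 ?_
      push_cast
      nlinarith [sq_nonneg (m : ℝ)]
    have h₂ : (searchTime m : ℝ) ≤ 200000 * ((m ^ (4 * m ^ 2) : ℕ) : ℝ) := by
      exact_mod_cast searchTime_le (show 3 ≤ m by omega)
    nlinarith

/-- A bound on the size of the kernel. -/
def kernelBound (m : ℕ) : ℕ :=
  2 * ((m + 2) * (m + 2)) + 2 * ((m + 1) * ((m + 1) * (m + 1)))

theorem computable_kernelBound : Computable kernelBound := by
  have hadd : ∀ c, Primrec fun m : ℕ => m + c := fun c =>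
    Primrec.nat_add.comp .id (.const c)
  have h2 : ∀ {f : ℕ → ℕ}, Primrec f → Primrec fun m => 2 * f m := fun hf =>
    Primrec.nat_mul.comp (.const 2) hf
  have hmul : ∀ {f g : ℕ → ℕ}, Primrec f → Primrec g → Primrec fun m => f m * g m :=
    fun hf hg => Primrec.nat_mul.comp hf hg
  exact (Primrec.nat_add.comp (h2 (hmul (hadd 2) (hadd 2)))
    (h2 (hmul (hadd 1) (hmul (hadd 1) (hadd 1))))).to_comp

theorem GNSPM.bnd_pow (I : GNSPM) : I.bnd ^ 1000 ≤ I.maxWord (8 * 1000) := by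
  rw [GNSPM.bnd, GNSPM.maxWord, pow_mul]

/-! ### The main theorem -/

theorem mainTheorem10 :
    -- Globally Nearly Stable Perfect Matching is solvable in `O(nm ^ (nm² log nm) * n²)` time
    (∃ (c : WordRAM.Cmd) (k : ℕ) (C : ℝ), ∀ I : GNSPM,
      ∃ (t : ℕ) (s : WordRAM.State),
        WordRAM.Exec (I.maxWord k) c (WordRAM.State.init I.encode) t s ∧
        s.Answers I.IsYes ∧
        (t : ℝ) ≤ C * ((I.nm : ℝ) ^ ((I.nm : ℝ) ^ 2 * Real.log I.nm) * (I.n : ℝ) ^ 2 + 1)) ∧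
    -- and has a kernel with at most `2 * nm` agents, computable in linear time
    (∃ (c : WordRAM.Cmd) (k : ℕ) (C : ℝ) (g : ℕ → ℕ), Computable g ∧ ∀ I : GNSPM,
      ∃ (t : ℕ) (s : WordRAM.State) (J : GNSPM),
        WordRAM.Exec (I.maxWord k) c (WordRAM.State.init I.encode) t s ∧
        s.Outputs J.encode ∧
        (J.IsYes ↔ I.IsYes) ∧
        2 * J.n ≤ max (2 * I.nm) 2 ∧
        J.size + J.d ≤ g I.nm ∧
        (t : ℝ) ≤ C * I.size) := by
  obtain ⟨K, hK, hT⟩ := exists_searchTime_le_rpow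
  -- The word exponent is that of `bnd` times the cost limit 1000. The summand 30000 covers 4800 for
  -- the linear phase and 20020 for the search with `n = 0`.
  refine ⟨⟨WordRAM.solve, 8 * 1000, K + 30000, fun I => ?_⟩,
    ⟨WordRAM.kernelize, 8 * 1000, 1200, kernelBound, computable_kernelBound, fun I => ?_⟩⟩
  · obtain ⟨t, s, he, ht, ha⟩ := WordRAM.solve_runs I.bnd_pow
    refine ⟨t, s, he, ha, ?_⟩
    change t ≤ 1200 * I.size + if I.n ≤ I.nm then searchTime I.n else 0 at ht
    have hE := one_le_rpow_sq_mul_log I.nm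
    have hT := hT I.nm
    set E := (I.nm : ℝ) ^ ((I.nm : ℝ) ^ 2 * Real.log I.nm)
    have hsz : (1200 * I.size : ℝ) ≤ 4800 * (I.n : ℝ) ^ 2 + 4800 := by
      have h : 1200 * I.size ≤ 4800 * I.n ^ 2 + 4800 := by
        have h₁ := I.size_le
        have h₂ := two_mul_le_add_sq I.n 1
        ring_nf at h₁ h₂ ⊢
        omega
      exact_mod_cast h
    have hn2 : (I.n : ℝ) ^ 2 ≤ E * (I.n : ℝ) ^ 2 := le_mul_of_one_le_left (sq_nonneg _) hE
    have hs : ((if I.n ≤ I.nm then searchTime I.n else 0 : ℕ) : ℝ) ≤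
        K * (E * (I.n : ℝ) ^ 2) + 20020 := by
      have hnn : 0 ≤ K * (E * (I.n : ℝ) ^ 2) := by positivity
      split_ifs with hle
      · rcases Nat.eq_zero_or_pos I.n with h0 | hpos
        -- The value is `(10000 + 10) * (0 ^ 0 + 1)`. It goes into the additive constant, as the
        -- main term vanishes for `n = 0`.
        · have : searchTime I.n = 20020 := by rw [h0]; rfl
          rw [this]
          push_cast
          linarith
        · have h₁ : (searchTime I.n : ℝ) ≤ searchTime I.nm := Nat.cast_le.2 (searchTime_mono hle)
          have h₂ : (1 : ℝ) ≤ (I.n : ℝ) ^ 2 := by exact_mod_cast Nat.one_le_pow 2 _ hpos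
          have h₃ : K * E ≤
              K * (E * (I.n : ℝ) ^ 2) := by
            gcongr
            exact le_mul_of_one_le_right (by linarith) h₂
          linarith
      · push_cast; linarith
    have ht' : (t : ℝ) ≤ 1200 * I.size + ((if I.n ≤ I.nm then searchTime I.n else 0 : ℕ) : ℝ) := by
      exact_mod_cast ht
    nlinarith [mul_nonneg hK (mul_nonneg (by linarith : (0 : ℝ) ≤ E) (sq_nonneg (I.n : ℝ)))]
  · obtain ⟨t, s, he, ht, J, hout, hyes, hn, hn', hd⟩ := WordRAM.kernelize_runs I.bnd_pow
    refine ⟨t, s, J, he, hout, hyes, hn, ?_, by exact_mod_cast ht⟩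
    have h₁ : (J.n + 1) ^ 2 ≤ (I.nm + 2) ^ 2 := Nat.pow_le_pow_left (by omega) 2
    have h₂ : J.n ^ 3 ≤ (I.nm + 1) ^ 3 := Nat.pow_le_pow_left hn' 3
    have h₃ := J.size_le
    have e : kernelBound I.nm = 2 * (I.nm + 2) ^ 2 + 2 * (I.nm + 1) ^ 3 := by
      unfold kernelBound; ring
    omega
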